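/- There is an absolute constant $c_0>0$ such that the following holds for every $0<c\le c_0$. Here random variables take only finitely many values. Write $\mathbb{H}[X]=\sum_x \mathbb{P}(X=x)\log\frac{1}{\mathbb{P}(X=x)}$ for the Shannon entropy (natural logarithm, $0\log\frac10=0$). For random variables $X,Y$ with values in an abelian group $G$, let $$d[X;Y] := \mathbb{H}[\tilde X-\tilde Y]-\tfrac12\mathbb{H}[X]-\tfrac12\mathbb{H}[Y],$$ where $\tilde X,\tilde Y$ are independent copies of $X,Y$. For a non-empty finite tuple $X_I=(X_i)_{i\in I}$ of $G$-valued random variables, let $$D[X_I] := \mathbb{H}\Bigl[\sum_{i\in I}\tilde X_i\Bigr]-\frac1{|I|}\sum_{i\in I}\mathbb{H}[X_i],$$ where the $\tilde X_i$ are independent copies of the $X_i$. Let $m\ge 2$ be an integer, let $G$ be an abelian group with $mg=0$ for all $g\in G$, put $\eta:=c/m^3$ and $I:=\{1,\dots,m\}$, and let $X_I$ be a tuple of $G$-valued random variables with $D[X_I]>0$. Then there is a tuple $X'_I$ of $G$-valued random variables such that $$D[X'_I]\le(1-\eta)\,D[X_I]-\eta\sum_{i\in I}d[X_i;X'_i].$$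 Moreover, if all the $X_i$ take values in a set $S\subseteq G$ with $S=-S$ and $0\in S$, then $X'_I$ can be chosen to satisfy this inequality with all the $X'_i$ taking values in the iterated sumset $m^3S=S+\dots+S$ ($m^3$ copies of $S$). -/

import Mathlib

open MeasureTheory

universe u v

noncomputable section

/-- A `G`-valued random variable in the sense of finitely-valued discrete random variables:
a probability space `(Ω, P)` together with a function `val : Ω → G` which takes only finitely many
values and each of whose fibres `{val = g}` is an event (this is what `SimpleFunc Ω G` says). Each random
variable carries its own sample space, so that the members of a tuple need not be defined jointly;
a tuple on a common sample space is the case in which all the sample spaces coincide. -/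
structure FinRV (G : Type u) where
  Ω : Type v
  [measurableSpace : MeasurableSpace Ω]
  P : Measure Ω
  [isProbabilityMeasure : IsProbabilityMeasure P]
  val : SimpleFunc Ω G

attribute [instance] FinRV.measurableSpace FinRV.isProbabilityMeasure

/-- The Shannon entropy `∑ x, p(x) log (1 / p(x))`, with `p(x) = P(Y = x)`, of a function `Y` on a
probability space. The natural logarithm is used, and `Real.negMulLog p = -p * log p` is `0` at
`p = 0`. The sum has only finitely many nonzero terms if `Y` takes finitely many values. -/
def entropy {Ω : Type v} [MeasurableSpace Ω] (P : Measure Ω) {G : Type u} (Y : Ω → G) : ℝ :=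
  ∑' x : G, Real.negMulLog (P.real (Y ⁻¹' {x}))

namespace FinRV

variable {G : Type u}

/-- The entropy `H[X]`. -/
def H (X : FinRV.{u, v} G) : ℝ := entropy X.P X.val

/-- `X` takes values in `S`. -/
def TakesValuesIn (X : FinRV.{u, v} G) (S : Set G) : Prop := ∀ ω, X.val ω ∈ S

variable [AddCommGroup G]

/-- The entropic Ruzsa distance `d[X; Y] = H[X̃ - Ỹ] - H[X] / 2 - H[Y] / 2`, where `X̃, Ỹ` are
independent copies of `X, Y`: the two coordinates of the product probability space. -/
def ruzsaDist (X Y : FinRV.{u, v} G) : ℝ :=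
  entropy (X.P.prod Y.P) (fun ω => X.val ω.1 - Y.val ω.2) - 1 / 2 * X.H - 1 / 2 * Y.H

/-- The multidistance `D[X_I] = H[∑ i, X̃ i] - (1 / |I|) ∑ i, H[X i]`, where the `X̃ i` are
independent copies of the `X i`: the coordinates of the product probability space. -/
def multidist {I : Type} [Fintype I] (X : I → FinRV.{u, v} G) : ℝ :=
  entropy (Measure.pi fun i => (X i).P) (fun ω => ∑ i, (X i).val (ω i))
    - 1 / (Fintype.card I : ℝ) * ∑ i, (X i).H

end FinRV

/-- The iterated sumset `ℓS = S + ⋯ + S` (`ℓ` copies of `S`). This is not the dilate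
`{ℓ • s | s ∈ S}`. -/
def iterSumset {G : Type u} [AddCommGroup G] (ℓ : ℕ) (S : Set G) : Set G :=
  {g | ∃ f : Fin ℓ → G, (∀ k, f k ∈ S) ∧ ∑ k, f k = g}

end

/-! Put m = n + 1 and k = D[X_I], and suppose that no tuple X' with values in T = m³S achieves the
decrement, so that every such tuple has D[X'] ≥ (1 - η)k - η ∑ d[X_i; X'_i] (`Law.NearMin`). Take an
m × m array of independent Y_ij, each Y_ij a copy of X_i, with total W. Let Z₁, Z₂, Z₃ be the sums
of the Y_ij weighted by i, j and -i - j, where residues mod m are represented in {0, …, m - 1}.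
Since mG = 0, Z₁ + Z₂ + Z₃ = 0.

Any two of the Z's are nearly independent given W. Indeed, if every column of an array is a
permutation of X_I, its row sums and column sums have mutual information at most 4m²ηk given W
(`array_mutual_information_le_of_nearMin`). The chain rule bounds this information through the
entropies of the column sums given the tail sums of the rows (`array_mutual_information_le`).
Near-minimality bounds these from below, applied to each column but the last, conditioned on tail
sums, and once more to the tuple of row sums. The main terms telescope away and only η times some
distances remains. Shearing the index square turns each pair of Z's into functions of rows and of
columns.

The entropic Balog-Szemerédi-Gowers inequality `FinProb.expect_doubling_cond_le` now shows that U,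
which is Z₂ conditioned on (Z₃, W), has average doubling H[U + U'] - H[U] at most the sum of the
three informations, hence at most 12m²ηk. So m copies of U have multidistance at most 12m³ηk = 12ck
on average, while their total distance from X_I is O(m³k) on average. Near-minimality tested on
these tuples is contradictory for small c.

All the entropy estimates rest on submodularity (`FinProb.ent_submodular`) and on concavity
(`Law.expect_H_le`). -/

/-! ### Entropy on finite probability spaces. -/

/-- A probability weight on a finite sample space. -/
structure FinProb (Ω : Type*) [Fintype Ω] where
  w : Ω → ℝ
  nonneg : ∀ ω, 0 ≤ w ω
  sum_eq_one : ∑ ω, w ω = 1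

namespace FinProb

variable {Ω : Type*} [Fintype Ω] {α β γ δ : Type*}

open Classical in
/-- The probability of the event `X = a`. -/
noncomputable def pr (p : FinProb Ω) (X : Ω → α) (a : α) : ℝ := ∑ ω, if X ω = a then p.w ω else 0

/-- The Shannon entropy of a function on a finite probability space. -/
noncomputable def ent (p : FinProb Ω) (X : Ω → α) : ℝ := ∑ ω, p.w ω * -Real.log (p.pr X (X ω))

variable (p : FinProb Ω)

lemma pr_nonneg (X : Ω → α) (a : α) : 0 ≤ p.pr X a :=
  Finset.sum_nonneg fun ω _ => by split_ifs <;> simp [p.nonneg]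

lemma pr_mono (X : Ω → α) (Y : Ω → β) (a : α) (b : β) (h : ∀ ω, X ω = a → Y ω = b) :
    p.pr X a ≤ p.pr Y b := by
  classical
  refine Finset.sum_le_sum fun ω _ => ?_
  by_cases h1 : X ω = a
  · simp [h1, h ω h1]
  · simp only [h1, if_false]; split_ifs <;> simp [p.nonneg]

lemma pr_congr (X : Ω → α) (Y : Ω → β) (a : α) (b : β) (h : ∀ ω, X ω = a ↔ Y ω = b) :
    p.pr X a = p.pr Y b :=
  le_antisymm (p.pr_mono X Y a b fun ω => (h ω).1) (p.pr_mono Y X b a fun ω => (h ω).2)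

lemma pr_const (a : α) : p.pr (fun _ => a) a = 1 := by
  simp [pr, p.sum_eq_one]

lemma w_le_pr (X : Ω → α) (ω : Ω) : p.w ω ≤ p.pr X (X ω) := by
  classical
  refine le_trans ?_ (Finset.single_le_sum (f := fun ω' => if X ω' = X ω then p.w ω' else 0)
    (fun ω' _ => by split_ifs <;> simp [p.nonneg]) (Finset.mem_univ ω))
  simp

lemma pr_pos (X : Ω → α) {ω : Ω} (h : 0 < p.w ω) : 0 < p.pr X (X ω) :=
  h.trans_le (p.w_le_pr X ω)

/-- Equality fails only for a null event, where division by zero makes the sum 0. -/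
lemma sum_ite_div_le (X : Ω → α) (a : α) [DecidablePred fun ω => X ω = a] :
    ∑ ω, (if X ω = a then p.w ω / p.pr X a else 0) ≤ 1 := by
  have : ∑ ω, (if X ω = a then p.w ω / p.pr X a else 0) = p.pr X a / p.pr X a := by
    conv_rhs => enter [1]; rw [pr]
    rw [Finset.sum_div]
    refine Finset.sum_congr rfl fun ω _ => ?_
    by_cases h : X ω = a <;> simp [h]
  rw [this]; exact div_self_le_one _

/-- Each fibre of `X` lies in a fibre of `Y`, so the inequality already holds pointwise for the
surprisals. -/
lemma ent_le_of_determines (X : Ω → α) (Y : Ω → β) (h : ∀ ω ω', X ω = X ω' → Y ω = Y ω') :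
    p.ent Y ≤ p.ent X := by
  refine Finset.sum_le_sum fun ω _ => ?_
  rcases (p.nonneg ω).eq_or_lt with h0 | h0
  · simp [← h0]
  refine mul_le_mul_of_nonneg_left (neg_le_neg ?_) h0.le
  exact Real.log_le_log (p.pr_pos X h0) (p.pr_mono _ _ _ _ fun ω' h' => h _ _ h')

lemma ent_congr (X : Ω → α) (Y : Ω → β) (h : ∀ ω ω', X ω = X ω' ↔ Y ω = Y ω') :
    p.ent X = p.ent Y :=
  le_antisymm (p.ent_le_of_determines Y X fun ω ω' => (h ω ω').2)
    (p.ent_le_of_determines X Y fun ω ω' => (h ω ω').1)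

lemma ent_const (a : α) : p.ent (fun _ => a) = 0 := by
  simp [ent, pr_const]

/-- Submodularity of the Shannon entropy: if `M` is a function of `A` and a function of `B`, and `J` is
a function of the pair `(A, B)`, then `H[J] + H[M] ≤ H[A] + H[B]`. -/
lemma ent_submodular (A : Ω → α) (B : Ω → β) (J : Ω → γ) (M : Ω → δ)
    (hA : ∀ ω ω', A ω = A ω' → M ω = M ω') (hB : ∀ ω ω', B ω = B ω' → M ω = M ω')
    (hJ : ∀ ω ω', A ω = A ω' → B ω = B ω' → J ω = J ω') :
    p.ent J + p.ent M ≤ p.ent A + p.ent B := by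
  classical
  let K : Ω → α × β := fun ω => (A ω, B ω)
  have hK : p.ent J ≤ p.ent K := p.ent_le_of_determines K J fun ω ω' h =>
    hJ ω ω' (congrArg Prod.fst h) (congrArg Prod.snd h)
  suffices p.ent K + p.ent M ≤ p.ent A + p.ent B by linarith
  -- The expectation of -log `r` is the conditional mutual information of `A` and `B` given `M`. By
  -- log x ≤ x - 1 its nonnegativity reduces to the expectation of `r` being at most 1.
  let r : Ω → ℝ := fun ω =>
    p.pr A (A ω) * p.pr B (B ω) / (p.pr K (K ω) * p.pr M (M ω))
  have h1 : p.ent K + p.ent M - p.ent A - p.ent B ≤ ∑ ω, p.w ω * (r ω - 1) := by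
    simp only [ent, ← Finset.sum_add_distrib, ← Finset.sum_sub_distrib]
    refine Finset.sum_le_sum fun ω _ => ?_
    rcases (p.nonneg ω).eq_or_lt with h0 | h0
    · simp [← h0]
    have a1 := p.pr_pos A h0
    have a2 := p.pr_pos B h0
    have a3 := p.pr_pos K h0
    have a4 := p.pr_pos M h0
    have : Real.log (r ω) = Real.log (p.pr A (A ω)) + Real.log (p.pr B (B ω))
        - (Real.log (p.pr K (K ω)) + Real.log (p.pr M (M ω))) := by
      rw [Real.log_div (by positivity) (by positivity), Real.log_mul a1.ne' a2.ne',
        Real.log_mul a3.ne' a4.ne']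
    have h2 := Real.log_le_sub_one_of_pos (show 0 < r ω by positivity)
    rw [this] at h2
    nlinarith
  have h2 : ∑ ω, p.w ω * r ω ≤ 1 := by
    have e : ∀ ω, p.w ω * r ω = ∑ ω₁, ∑ ω₂, (p.w ω₁ * p.w ω₂) *
        ((if A ω₁ = A ω then 1 else 0) * (if B ω₂ = B ω then 1 else 0) *
          (p.w ω / p.pr K (K ω) / p.pr M (M ω))) := by
      intro ω
      have : p.w ω * r ω = (p.pr A (A ω) * p.pr B (B ω)) *
          (p.w ω / p.pr K (K ω) / p.pr M (M ω)) := by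
        simp only [r]; ring
      rw [this, pr, pr, Finset.sum_mul_sum, Finset.sum_mul]
      refine Finset.sum_congr rfl fun ω₁ _ => ?_
      rw [Finset.sum_mul]
      refine Finset.sum_congr rfl fun ω₂ _ => ?_
      split_ifs <;> ring
    simp_rw [e]
    rw [Finset.sum_comm]
    have e2 : ∀ ω₁, ∑ ω, ∑ ω₂, (p.w ω₁ * p.w ω₂) *
        ((if A ω₁ = A ω then 1 else 0) * (if B ω₂ = B ω then 1 else 0) *
          (p.w ω / p.pr K (K ω) / p.pr M (M ω))) ≤
        p.w ω₁ * ∑ ω₂, (if M ω₂ = M ω₁ then p.w ω₂ / p.pr M (M ω₁) else 0) := by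
      intro ω₁
      rw [Finset.sum_comm, Finset.mul_sum]
      refine Finset.sum_le_sum fun ω₂ _ => ?_
      rw [← Finset.mul_sum, mul_assoc]
      refine mul_le_mul_of_nonneg_left ?_ (p.nonneg _)
      -- A point `ω` agreeing with `ω₁` in `A` and with `ω₂` in `B` forces `M ω₁ = M ω₂`. The sum
      -- over `ω` and then the one over `ω₂` are thus sums of conditional probabilities.
      have e3 : ∀ ω, ((if A ω₁ = A ω then (1 : ℝ) else 0) * (if B ω₂ = B ω then 1 else 0) *
          (p.w ω / p.pr K (K ω) / p.pr M (M ω))) =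
          (if M ω₂ = M ω₁ then 1 / p.pr M (M ω₁) else 0) *
          (if K ω = (A ω₁, B ω₂) then p.w ω / p.pr K (A ω₁, B ω₂) else 0) := by
        intro ω
        by_cases hk : K ω = (A ω₁, B ω₂)
        · have k1 : A ω = A ω₁ := congrArg Prod.fst hk
          have k2 : B ω = B ω₂ := congrArg Prod.snd hk
          have m1 := hA _ _ k1
          have m2 := hB _ _ k2
          rw [hk]
          simp [← k1, ← k2, ← m1, ← m2]
          ring
        · have : ¬ (A ω₁ = A ω ∧ B ω₂ = B ω) := fun h => hk (Prod.ext h.1.symm h.2.symm)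
          simp only [hk, if_false, mul_zero]
          by_cases q : A ω₁ = A ω
          · have : ¬ B ω₂ = B ω := fun h => this ⟨q, h⟩
            simp [this]
          · simp [q]
      simp_rw [e3]
      rw [← Finset.mul_sum]
      have := p.sum_ite_div_le K (A ω₁, B ω₂)
      by_cases hm : M ω₂ = M ω₁
      · simp only [hm, if_true]
        calc _ ≤ p.w ω₂ * (1 / p.pr M (M ω₁) * 1) := by
              refine mul_le_mul_of_nonneg_left (mul_le_mul_of_nonneg_left this ?_) (p.nonneg _)
              exact div_nonneg zero_le_one (p.pr_nonneg _ _)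
          _ = _ := by ring
      · simp [hm]
    calc _ ≤ ∑ ω₁, p.w ω₁ * 1 := by
          refine Finset.sum_le_sum fun ω₁ _ => (e2 ω₁).trans ?_
          exact mul_le_mul_of_nonneg_left (p.sum_ite_div_le M (M ω₁)) (p.nonneg _)
      _ = 1 := by simp [p.sum_eq_one]
  have h3 : ∑ ω, p.w ω * (r ω - 1) = ∑ ω, p.w ω * r ω - 1 := by
    simp [mul_sub, p.sum_eq_one]
  linarith

lemma ent_pair_le (A : Ω → α) (B : Ω → β) :
    p.ent (fun ω => (A ω, B ω)) ≤ p.ent A + p.ent B := by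
  have := p.ent_submodular A B (fun ω => (A ω, B ω)) (fun _ => ()) (fun _ _ _ => rfl)
    (fun _ _ _ => rfl) (fun _ _ h h' => by simp [h, h'])
  rwa [p.ent_const, add_zero] at this

/-- Functions of independent variables are independent, in terms of entropies. -/
lemma ent_add_le_of_indep (A : Ω → α) (B : Ω → β) (A' : Ω → γ) (B' : Ω → δ)
    (h : p.ent A + p.ent B ≤ p.ent (fun ω => (A ω, B ω)))
    (hA : ∀ ω ω', A ω = A ω' → A' ω = A' ω') (hB : ∀ ω ω', B ω = B ω' → B' ω = B' ω') :
    p.ent A' + p.ent B' ≤ p.ent (fun ω => (A' ω, B' ω)) := by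
  -- Coarsen one variable at a time, passing through the pair `(A', B)`.
  have h1 := p.ent_submodular A (fun ω => (A' ω, B ω)) (fun ω => (A ω, B ω)) A' hA
    (fun ω ω' h => congrArg Prod.fst h) (fun ω ω' h h' => by simp_all)
  have h2 := p.ent_submodular B (fun ω => (A' ω, B' ω)) (fun ω => (A' ω, B ω)) B' hB
    (fun ω ω' h => congrArg Prod.snd h) (fun ω ω' h h' => by simp_all)
  linarith

lemma ent_pi_le {ι : Type*} [Fintype ι] {α : ι → Type*} (A : ∀ i, Ω → α i) (s : Finset ι) :
    p.ent (fun ω (i : s) => A i ω) ≤ ∑ i ∈ s, p.ent (A i) := by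
  classical
  induction s using Finset.induction_on with
  | empty =>
    refine le_of_eq ?_
    rw [Finset.sum_empty, ← p.ent_const ()]
    refine p.ent_congr _ _ fun ω ω' => ?_
    simp [funext_iff]
  | insert a s ha ih =>
    rw [Finset.sum_insert ha]
    refine le_trans ?_ (add_le_add_right ih _)
    refine le_trans ?_ (p.ent_pair_le _ _)
    refine p.ent_le_of_determines _ _ fun ω ω' h => ?_
    obtain ⟨h1, h2⟩ := Prod.ext_iff.1 h
    funext ⟨i, hi⟩
    rcases Finset.mem_insert.1 hi with rfl | hi
    · exact h1
    · exact congrFun h2 ⟨i, hi⟩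

/-! ### Expectation and conditioning. -/

/-- The expectation of a function on a finite probability space. -/
noncomputable def expect (f : Ω → ℝ) : ℝ := ∑ ω, p.w ω * f ω

lemma expect_mono {f g : Ω → ℝ} (h : ∀ ω, 0 < p.w ω → f ω ≤ g ω) : p.expect f ≤ p.expect g := by
  refine Finset.sum_le_sum fun ω _ => ?_
  rcases (p.nonneg ω).eq_or_lt with h0 | h0
  · simp [← h0]
  · exact mul_le_mul_of_nonneg_left (h ω h0) h0.le

lemma expect_congr {f g : Ω → ℝ} (h : ∀ ω, 0 < p.w ω → f ω = g ω) : p.expect f = p.expect g :=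
  le_antisymm (p.expect_mono fun ω hω => (h ω hω).le) (p.expect_mono fun ω hω => (h ω hω).ge)

lemma expect_const (c : ℝ) : p.expect (fun _ => c) = c := by
  simp [expect, ← Finset.sum_mul, p.sum_eq_one]

lemma expect_add (f g : Ω → ℝ) : p.expect (fun ω => f ω + g ω) = p.expect f + p.expect g := by
  simp [expect, mul_add, Finset.sum_add_distrib]

lemma expect_sub (f g : Ω → ℝ) : p.expect (fun ω => f ω - g ω) = p.expect f - p.expect g := by
  simp [expect, mul_sub, Finset.sum_sub_distrib]

lemma expect_const_mul (c : ℝ) (f : Ω → ℝ) : p.expect (fun ω => c * f ω) = c * p.expect f := by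
  simp only [expect, Finset.mul_sum]
  exact Finset.sum_congr rfl fun _ _ => by ring

lemma expect_sum {ι : Type*} (s : Finset ι) (f : ι → Ω → ℝ) :
    p.expect (fun ω => ∑ i ∈ s, f i ω) = ∑ i ∈ s, p.expect (f i) := by
  simp only [expect, Finset.mul_sum]
  exact Finset.sum_comm

/-- The conditioning of a probability weight on the event `V = v`, provided it has positive
probability. -/
noncomputable def cond (V : Ω → β) (v : β) : FinProb Ω := by
  classical
  -- The value at a null event is arbitrary: averages over the values of `V` give it weight 0.
  exact if h : p.pr V v = 0 then p else
  { w := fun ω => if V ω = v then p.w ω / p.pr V v else 0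
    nonneg := fun ω => by
      split_ifs
      · exact div_nonneg (p.nonneg _) (p.pr_nonneg _ _)
      · exact le_rfl
    sum_eq_one := by
      rw [← div_self h]
      conv_rhs => rw [pr]; enter [2]; rw [← pr]
      rw [Finset.sum_div]
      exact Finset.sum_congr rfl fun ω _ => by split_ifs <;> simp }

open Classical in
lemma cond_w (V : Ω → β) {v : β} (h : p.pr V v ≠ 0) (ω : Ω) :
    (p.cond V v).w ω = if V ω = v then p.w ω / p.pr V v else 0 := by
  simp [cond, h]

lemma cond_pr (V : Ω → β) {v : β} (h : p.pr V v ≠ 0) (X : Ω → α) (a : α) :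
    (p.cond V v).pr X a = p.pr (fun ω => (X ω, V ω)) (a, v) / p.pr V v := by
  classical
  rw [pr, pr, Finset.sum_div]
  refine Finset.sum_congr rfl fun ω _ => ?_
  rw [cond_w _ _ h]
  by_cases h1 : X ω = a <;> by_cases h2 : V ω = v <;> simp [h1, h2]

lemma sum_cond (V : Ω → β) (f : Ω → ℝ) :
    p.expect (fun ω => (p.cond V (V ω)).expect f) = p.expect f := by
  classical
  simp only [expect, Finset.mul_sum]
  rw [Finset.sum_comm]
  refine Finset.sum_congr rfl fun ω _ => ?_
  rcases (p.nonneg ω).eq_or_lt with h0 | h0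
  · refine (Finset.sum_eq_zero fun ω' _ => ?_).trans (by simp [← h0])
    rcases (p.nonneg ω').eq_or_lt with h0' | h0'
    · simp [← h0']
    · rw [cond_w _ _ (p.pr_pos V h0').ne']
      split_ifs <;> simp [← h0]
  · have hv := p.pr_pos V h0
    have : ∀ ω', p.w ω' * ((p.cond V (V ω')).w ω * f ω) =
        (p.w ω * f ω / p.pr V (V ω)) * (if V ω' = V ω then p.w ω' else 0) := by
      intro ω'
      rcases (p.nonneg ω').eq_or_lt with h0' | h0'
      · simp [← h0']
      · rw [cond_w _ _ (p.pr_pos V h0').ne']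
        by_cases h : V ω' = V ω
        · simp [h]; ring
        · have : ¬ V ω = V ω' := fun h' => h h'.symm
          simp [h, this]
    simp_rw [this, ← Finset.mul_sum]
    change p.w ω * f ω / p.pr V (V ω) * p.pr V (V ω) = _
    field_simp

lemma pos_of_cond_pos (V : Ω → β) {v : β} (h : p.pr V v ≠ 0) {ω : Ω} (hω : 0 < (p.cond V v).w ω) :
    0 < p.w ω ∧ V ω = v := by
  classical
  rw [cond_w _ _ h] at hω
  split_ifs at hω with h1
  · refine ⟨(p.nonneg ω).lt_of_ne' fun h0 => ?_, h1⟩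
    simp [h0] at hω
  · exact absurd hω (lt_irrefl _)

/-- The chain rule: the average entropy of the conditionings of `X` on the values of `V`. -/
lemma expect_ent_cond (V : Ω → β) (X : Ω → α) :
    p.expect (fun ω => (p.cond V (V ω)).ent X) = p.ent (fun ω => (X ω, V ω)) - p.ent V := by
  have h : p.expect (fun ω => (p.cond V (V ω)).ent X) =
      p.expect (fun ω => (p.cond V (V ω)).expect
        fun ω => -Real.log (p.pr (fun ω => (X ω, V ω)) (X ω, V ω)) - -Real.log (p.pr V (V ω))) := by
    refine p.expect_congr fun ω h0 => ?_
    have hv := p.pr_pos V h0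
    refine expect_congr _ fun ω' h1 => ?_
    obtain ⟨h2, h3⟩ := p.pos_of_cond_pos V hv.ne' h1
    rw [cond_pr _ _ hv.ne', h3, Real.log_div, neg_sub]
    · ring
    · rw [← h3]; exact (p.pr_pos (fun ω => (X ω, V ω)) h2).ne'
    · exact hv.ne'
  rw [h, sum_cond, expect_sub]; rfl

/-! ### Push-forwards and products. -/

/-- `f` pushes the weight `p` forward to the weight `q`. -/
def IsPush {Ω' : Type*} [Fintype Ω'] (q : FinProb Ω') (f : Ω → Ω') : Prop :=
  ∀ ω', p.pr f ω' = q.w ω'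

variable {p}

lemma IsPush.expect {Ω' : Type*} [Fintype Ω'] {q : FinProb Ω'} {f : Ω → Ω'} (h : p.IsPush q f)
    (g : Ω' → ℝ) : p.expect (fun ω => g (f ω)) = q.expect g := by
  classical
  simp only [FinProb.expect, ← h _, pr, Finset.sum_mul]
  rw [Finset.sum_comm]
  refine Finset.sum_congr rfl fun ω _ => ?_
  simp

lemma IsPush.pr {Ω' : Type*} [Fintype Ω'] {q : FinProb Ω'} {f : Ω → Ω'} (h : p.IsPush q f)
    (X : Ω' → α) (a : α) : p.pr (fun ω => X (f ω)) a = q.pr X a := by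
  classical
  have := h.expect (fun ω => if X ω = a then 1 else 0)
  simpa [FinProb.expect, FinProb.pr] using this

lemma IsPush.ent {Ω' : Type*} [Fintype Ω'] {q : FinProb Ω'} {f : Ω → Ω'} (h : p.IsPush q f)
    (X : Ω' → α) : p.ent (fun ω => X (f ω)) = q.ent X := by
  simp only [FinProb.ent, h.pr]
  exact h.expect fun ω => -Real.log (q.pr X (X ω))

variable (p)

/-- The product of two probability weights. -/
def prod {Ω' : Type*} [Fintype Ω'] (q : FinProb Ω') : FinProb (Ω × Ω') where
  w ω := p.w ω.1 * q.w ω.2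
  nonneg ω := mul_nonneg (p.nonneg _) (q.nonneg _)
  sum_eq_one := by
    rw [Fintype.sum_prod_type]
    simp [← Finset.mul_sum, p.sum_eq_one, q.sum_eq_one]

lemma isPush_fst {Ω' : Type*} [Fintype Ω'] (q : FinProb Ω') : (p.prod q).IsPush p Prod.fst := by
  classical
  intro ω
  simp only [FinProb.pr, Fintype.sum_prod_type, prod]
  rw [Finset.sum_eq_single ω]
  · simp [← Finset.mul_sum, q.sum_eq_one]
  · intro b _ hb; simp [hb]
  · simp

lemma isPush_snd {Ω' : Type*} [Fintype Ω'] (q : FinProb Ω') : (p.prod q).IsPush q Prod.snd := by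
  classical
  intro ω
  simp only [FinProb.pr, Fintype.sum_prod_type_right, prod]
  rw [Finset.sum_eq_single ω]
  · simp [← Finset.sum_mul, p.sum_eq_one]
  · intro b _ hb; simp [hb]
  · simp

lemma prod_pr {Ω' : Type*} [Fintype Ω'] (q : FinProb Ω') (X : Ω → α) (Y : Ω' → β) (a : α) (b : β) :
    (p.prod q).pr (fun ω => (X ω.1, Y ω.2)) (a, b) = p.pr X a * q.pr Y b := by
  classical
  simp only [FinProb.pr, Fintype.sum_prod_type, prod, Finset.sum_mul_sum]
  refine Finset.sum_congr rfl fun ω _ => Finset.sum_congr rfl fun ω' _ => ?_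
  by_cases h1 : X ω = a <;> by_cases h2 : Y ω' = b <;> simp [h1, h2]

lemma ent_prod {Ω' : Type*} [Fintype Ω'] (q : FinProb Ω') (X : Ω → α) (Y : Ω' → β) :
    (p.prod q).ent (fun ω => (X ω.1, Y ω.2)) = p.ent X + q.ent Y := by
  rw [← (p.isPush_fst q).ent X, ← (p.isPush_snd q).ent Y]
  have : ∀ Z : Ω × Ω' → α × β, (p.prod q).ent Z =
    (p.prod q).expect fun ω => -Real.log ((p.prod q).pr Z (Z ω)) := fun _ => rfl
  rw [this]
  change _ = (p.prod q).expect _ + (p.prod q).expect _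
  rw [← expect_add]
  refine expect_congr _ fun ω h0 => ?_
  have h1 := pr_pos _ (fun ω : Ω × Ω' => X ω.1) h0
  have h2 := pr_pos _ (fun ω : Ω × Ω' => Y ω.2) h0
  rw [prod_pr, ← (p.isPush_fst q).pr X, ← (p.isPush_snd q).pr Y, Real.log_mul h1.ne' h2.ne']
  ring

section Pi

variable {ι : Type*} [Fintype ι] [DecidableEq ι] {B : Type*} [Fintype B]

/-- The product of a finite family of probability weights. -/
def pi (q : ι → FinProb B) : FinProb (ι → B) where
  w ω := ∏ i, (q i).w (ω i)
  nonneg ω := Finset.prod_nonneg fun i _ => (q i).nonneg _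
  sum_eq_one := by
    have := Finset.prod_univ_sum (fun _ : ι => (Finset.univ : Finset B)) fun i b => (q i).w b
    rw [Fintype.piFinset_univ] at this
    rw [← this]
    simp [(q _).sum_eq_one]

lemma pi_pr (q : ι → FinProb B) {α : ι → Type*} (X : ∀ i, B → α i) (a : ∀ i, α i) :
    (pi q).pr (fun ω i => X i (ω i)) a = ∏ i, (q i).pr (X i) (a i) := by
  classical
  have := Finset.prod_univ_sum (fun _ : ι => (Finset.univ : Finset B))
    fun i b => if X i b = a i then (q i).w b else 0
  rw [Fintype.piFinset_univ] at this
  simp only [FinProb.pr, this]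
  refine Finset.sum_congr rfl fun ω _ => ?_
  by_cases h : ∀ i, X i (ω i) = a i
  · simp [h, pi]
  · rw [if_neg (fun h' => h fun i => congrFun h' i)]
    push Not at h
    obtain ⟨i, hi⟩ := h
    exact (Finset.prod_eq_zero (Finset.mem_univ i) (by simp [hi])).symm

lemma isPush_eval (q : ι → FinProb B) (i : ι) : (pi q).IsPush (q i) (fun ω => ω i) := by
  classical
  intro b
  -- Collapsing every coordinate but the `i`-th to the constant `none` makes all the other factors
  -- equal to 1.
  have h := pi_pr q (α := fun _ => Option B) (fun j b => if j = i then some b else none)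
    (fun j => if j = i then some b else none)
  rw [Finset.prod_eq_single i] at h
  · rw [(pi q).pr_congr (fun ω => ω i) (fun ω j => if j = i then some (ω j) else none) b
      (fun j => if j = i then some b else none)]
    · rw [h]
      simp only [if_true, FinProb.pr, Option.some_inj]
      simp
    · intro ω
      constructor
      · rintro rfl; funext j
        by_cases hj : j = i
        · subst hj; simp
        · simp [hj]
      · intro h; simpa using congrFun h i
  · intro j _ hj
    simp only [hj, if_false]
    exact pr_const _ _
  · simp

lemma ent_pi (q : ι → FinProb B) {α : ι → Type*} (X : ∀ i, B → α i) :
    (pi q).ent (fun ω i => X i (ω i)) = ∑ i, (q i).ent (X i) := by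
  have : ∀ i, (q i).ent (X i) = (pi q).expect fun ω =>
      -Real.log ((q i).pr (X i) (X i (ω i))) := fun i =>
    ((isPush_eval q i).expect fun b => -Real.log ((q i).pr (X i) (X i b))).symm
  simp_rw [this]
  rw [← expect_sum]
  refine expect_congr _ fun ω h0 => ?_
  rw [pi_pr, Real.log_prod, Finset.sum_neg_distrib]
  intro i _
  rw [← (isPush_eval q i).pr]
  exact (pr_pos _ (fun ω : ι → B => X i (ω i)) h0).ne'

end Pi

end FinProb

/-! ### Laws as elements of the group algebra: convolution, reflection, dilation. -/

section Law

variable (G : Type*) [AddCommGroup G]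

/-- The submonoid of the group algebra formed by the finitely supported probability measures; its
multiplication is convolution. -/
noncomputable def lawSubmonoid : Submonoid (AddMonoidAlgebra ℝ G) where
  carrier := {x | (∀ g, 0 ≤ x.coeff g) ∧ AddMonoidAlgebra.lift ℝ ℝ G 1 x = 1}
  one_mem' := by
    classical
    refine ⟨fun g => ?_, map_one _⟩
    rw [AddMonoidAlgebra.one_def, AddMonoidAlgebra.coeff_single, Finsupp.single_apply]
    split_ifs <;> norm_num
  mul_mem' {x y} hx hy := by
    classical
    refine ⟨fun g => ?_, by rw [map_mul, hx.2, hy.2, one_mul]⟩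
    rw [AddMonoidAlgebra.coeff_mul]
    refine Finset.sum_nonneg fun a _ => Finset.sum_nonneg fun b _ => ?_
    change 0 ≤ if a + b = g then x.coeff a * y.coeff b else 0
    split_ifs
    · exact mul_nonneg (hx.1 _) (hy.1 _)
    · exact le_rfl

/-- The finitely supported probability measures on an abelian group, under convolution. -/
abbrev Law := ↥(lawSubmonoid G)

variable {G} {Ω Ω' : Type*} [Fintype Ω] [Fintype Ω']

namespace FinProb

omit [AddCommGroup G] in
lemma law_aux_coeff (p : FinProb Ω) (X : Ω → G) (g : G) :
    (∑ ω, AddMonoidAlgebra.single (X ω) (p.w ω)).coeff g = p.pr X g := by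
  classical
  simp [pr, Finsupp.single_apply, Finsupp.finsetSum_apply]

/-- The law of a group-valued function on a finite probability space. -/
noncomputable def law (p : FinProb Ω) (X : Ω → G) : Law G :=
  ⟨∑ ω, AddMonoidAlgebra.single (X ω) (p.w ω), fun g => by
    rw [law_aux_coeff]; exact p.pr_nonneg _ _, by
    rw [map_sum]
    simp [AddMonoidAlgebra.lift_single, p.sum_eq_one]⟩

lemma law_val (p : FinProb Ω) (X : Ω → G) :
    (p.law X).1 = ∑ ω, AddMonoidAlgebra.single (X ω) (p.w ω) := rfl

lemma law_coeff (p : FinProb Ω) (X : Ω → G) (g : G) : (p.law X).1.coeff g = p.pr X g :=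
  p.law_aux_coeff X g

lemma law_congr (p : FinProb Ω) (q : FinProb Ω') (X : Ω → G) (Y : Ω' → G)
    (h : ∀ g, p.pr X g = q.pr Y g) : p.law X = q.law Y := by
  apply Subtype.ext
  ext g
  rw [law_coeff, law_coeff, h]

lemma IsPush.law {p : FinProb Ω} {q : FinProb Ω'} {f : Ω → Ω'} (h : p.IsPush q f) (X : Ω' → G) :
    p.law (fun ω => X (f ω)) = q.law X :=
  p.law_congr q _ _ fun g => h.pr X g

lemma law_add_prod (p : FinProb Ω) (q : FinProb Ω') (X : Ω → G) (Y : Ω' → G) :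
    (p.prod q).law (fun ω => X ω.1 + Y ω.2) = p.law X * q.law Y := by
  apply Subtype.ext
  rw [Submonoid.coe_mul, law_val, law_val, law_val, Finset.sum_mul_sum, Fintype.sum_prod_type]
  simp [prod]

lemma law_sum_pi {ι : Type*} [Fintype ι] [DecidableEq ι] (q : ι → FinProb Ω) (X : ι → Ω → G) :
    (pi q).law (fun ω => ∑ i, X i (ω i)) = ∏ i, (q i).law (X i) := by
  apply Subtype.ext
  have := Finset.prod_univ_sum (fun _ : ι => (Finset.univ : Finset Ω))
    fun i b => AddMonoidAlgebra.single (X i b) ((q i).w b)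
  rw [Fintype.piFinset_univ] at this
  rw [Submonoid.coe_finsetProd]
  simp only [law_val, this, pi]
  refine Finset.sum_congr rfl fun ω _ => ?_
  have key : ∀ s : Finset ι, ∏ i ∈ s, AddMonoidAlgebra.single (X i (ω i)) ((q i).w (ω i)) =
      AddMonoidAlgebra.single (∑ i ∈ s, X i (ω i)) (∏ i ∈ s, (q i).w (ω i)) := by
    intro s
    induction s using Finset.induction_on with
    | empty => simp [AddMonoidAlgebra.one_def]
    | insert a s ha ih => simp [Finset.prod_insert ha, Finset.sum_insert ha, ih]
  exact (key _).symm

lemma law_const_zero (p : FinProb Ω) : p.law (fun _ => (0 : G)) = 1 := by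
  apply Subtype.ext
  ext g
  classical
  rw [law_coeff, Submonoid.coe_one, AddMonoidAlgebra.one_def, AddMonoidAlgebra.coeff_single,
    Finsupp.single_apply]
  split_ifs with h
  · rw [← h, pr_const]
  · simp [pr, h]

/-- The tower property as a linear identity, so that it survives convolution with a fixed law. -/
lemma law_cond_average {β : Type*} (p : FinProb Ω) (V : Ω → β) (X : Ω → G) :
    ∑ ω, p.w ω • ((p.cond V (V ω)).law X).1 = (p.law X).1 := by
  classical
  ext g
  rw [law_coeff, AddMonoidAlgebra.coeff_sum, Finsupp.finsetSum_apply]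
  have := p.sum_cond V (fun ω => if X ω = g then 1 else 0)
  simp only [expect, mul_ite, mul_one, mul_zero] at this
  rw [pr, ← this]
  refine Finset.sum_congr rfl fun ω _ => ?_
  rw [AddMonoidAlgebra.coeff_smul, Finsupp.smul_apply, law_coeff, smul_eq_mul, pr]

end FinProb

namespace Law

lemma nonneg (μ : Law G) (g : G) : 0 ≤ μ.1.coeff g := μ.2.1 g

lemma sum_support (μ : Law G) : ∑ g ∈ μ.1.coeff.support, μ.1.coeff g = 1 := by
  have := μ.2.2
  rw [AddMonoidAlgebra.lift_apply] at this
  simpa [Finsupp.sum] using this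

/-- The canonical sample space of a law. -/
noncomputable def space (μ : Law G) : FinProb μ.1.coeff.support where
  w g := μ.1.coeff (g : G)
  nonneg g := μ.nonneg g
  sum_eq_one := by
    rw [← sum_support μ]
    exact Finset.sum_coe_sort μ.1.coeff.support fun g => μ.1.coeff g

lemma law_space (μ : Law G) : μ.space.law (fun g => (g : G)) = μ := by
  classical
  apply Subtype.ext
  ext g
  rw [FinProb.law_coeff, FinProb.pr]
  have : ∑ ω : μ.1.coeff.support, (if (ω : G) = g then μ.space.w ω else 0) =
      ∑ x ∈ μ.1.coeff.support, (if x = g then μ.1.coeff x else 0) := by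
    exact Finset.sum_coe_sort μ.1.coeff.support fun x => if x = g then μ.1.coeff x else 0
  rw [this, Finset.sum_ite_eq']
  simp +contextual [eq_comm]

/-- The image of a law under a group endomorphism. -/
noncomputable def map (f : G →+ G) : Law G →* Law G where
  toFun μ := μ.space.law (fun g => f g)
  map_one' := by
    apply Subtype.ext
    ext g
    rw [FinProb.law_coeff]
    rw [FinProb.pr_congr _ _ (fun _ => (0 : G)) g g, ← FinProb.law_coeff, FinProb.law_const_zero]
    rintro ⟨ω, hω⟩
    classical
    have : ω = 0 := by
      by_contra h
      rw [Submonoid.coe_one, AddMonoidAlgebra.one_def, AddMonoidAlgebra.coeff_single,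
        Finsupp.mem_support_iff, Finsupp.single_apply, if_neg (Ne.symm h)] at hω
      exact hω rfl
    simp [this]
  map_mul' μ ν := by
    have key : ∀ μ : Law G, (μ.space.law (fun g => f g)).1 =
        AddMonoidAlgebra.mapDomainRingHom ℝ f μ.1 := by
      intro μ
      conv_rhs => rw [← law_space μ]
      rw [FinProb.law_val, FinProb.law_val, map_sum]
      simp
    apply Subtype.ext
    refine (key _).trans ?_
    change _ = (μ.space.law fun g => f g).1 * (ν.space.law fun g => f g).1
    rw [key, key, Submonoid.coe_mul, map_mul]

lemma map_val (f : G →+ G) (μ : Law G) :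
    (map f μ).1 = AddMonoidAlgebra.mapDomainRingHom ℝ f μ.1 := by
  conv_rhs => rw [← law_space μ]
  rw [FinProb.law_val, map_sum]
  simp [map, FinProb.law_val]

lemma map_law (f : G →+ G) (p : FinProb Ω) (X : Ω → G) :
    map f (p.law X) = p.law (fun ω => f (X ω)) := by
  apply Subtype.ext
  rw [map_val, FinProb.law_val, FinProb.law_val, map_sum]
  simp

/-- The law of `-X`. -/
noncomputable def neg : Law G →* Law G := map (-AddMonoidHom.id G)

/-- The law of `n • X`. -/
noncomputable def dil (n : ℕ) : Law G →* Law G := map (n • AddMonoidHom.id G)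

lemma neg_law (p : FinProb Ω) (X : Ω → G) : neg (p.law X) = p.law (fun ω => -X ω) := by
  simp [neg, map_law]

lemma dil_law (n : ℕ) (p : FinProb Ω) (X : Ω → G) :
    dil n (p.law X) = p.law (fun ω => n • X ω) := by
  simp [dil, map_law]

lemma dil_zero (μ : Law G) : dil 0 μ = 1 := by
  rw [← law_space μ, dil_law]; simp [FinProb.law_const_zero]

lemma dil_one (μ : Law G) : dil 1 μ = μ := by
  conv_rhs => rw [← law_space μ]
  conv_lhs => rw [← law_space μ, dil_law]
  simp

lemma neg_neg (μ : Law G) : neg (neg μ) = μ := by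
  rw [← law_space μ, neg_law, neg_law]; simp

/-- The Shannon entropy of a finitely supported element of the group algebra. -/
noncomputable def ent (x : AddMonoidAlgebra ℝ G) : ℝ :=
  ∑ g ∈ x.coeff.support, Real.negMulLog (x.coeff g)

omit [AddCommGroup G] in
lemma ent_eq_sum (x : AddMonoidAlgebra ℝ G) {s : Finset G} (h : x.coeff.support ⊆ s) :
    ent x = ∑ g ∈ s, Real.negMulLog (x.coeff g) := by
  refine Finset.sum_subset h fun g _ hg => ?_
  rw [Finsupp.notMem_support_iff.1 hg, Real.negMulLog_zero]

end Law

lemma FinProb.ent_law (p : FinProb Ω) (X : Ω → G) : Law.ent (p.law X).1 = p.ent X := by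
  classical
  have hs : (p.law X).1.coeff.support ⊆ Finset.univ.image X := by
    intro g hg
    rw [Finsupp.mem_support_iff, law_coeff, pr] at hg
    obtain ⟨ω, -, h⟩ := Finset.exists_ne_zero_of_sum_ne_zero hg
    refine Finset.mem_image.2 ⟨ω, Finset.mem_univ _, ?_⟩
    by_contra h'
    exact h (if_neg h')
  rw [Law.ent_eq_sum _ hs]
  have : ∀ g, Real.negMulLog ((p.law X).1.coeff g) =
      ∑ ω, if X ω = g then p.w ω * -Real.log (p.pr X (X ω)) else 0 := by
    intro g
    rw [law_coeff, Real.negMulLog, neg_mul, ← mul_neg]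
    conv_lhs => enter [1]; rw [pr]
    rw [Finset.sum_mul]
    refine Finset.sum_congr rfl fun ω _ => ?_
    by_cases h : X ω = g <;> simp [h]
  simp_rw [this]
  rw [Finset.sum_comm, FinProb.ent]
  refine Finset.sum_congr rfl fun ω _ => ?_
  rw [Finset.sum_ite_eq]
  simp

/-! ### Entropic sumset inequalities. -/

namespace Law

/-- The Shannon entropy of a law. -/
noncomputable def H (μ : Law G) : ℝ := ent μ.1

lemma H_law (p : FinProb Ω) (X : Ω → G) : H (p.law X) = p.ent X := p.ent_law X

/-- Concavity of the entropy. -/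
lemma expect_H_le (p : FinProb Ω) (μ : Ω → Law G) (ν : Law G)
    (h : ∑ ω, p.w ω • (μ ω).1 = ν.1) : p.expect (fun ω => H (μ ω)) ≤ H ν := by
  classical
  let s : Finset G := (Finset.univ.biUnion fun ω => (μ ω).1.coeff.support) ∪ ν.1.coeff.support
  have h1 : ∀ ω, H (μ ω) = ∑ g ∈ s, Real.negMulLog ((μ ω).1.coeff g) := fun ω =>
    ent_eq_sum _ ((Finset.subset_biUnion_of_mem (fun ω => (μ ω).1.coeff.support)
      (Finset.mem_univ ω)).trans Finset.subset_union_left)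
  rw [H, ent_eq_sum ν.1 (s := s) Finset.subset_union_right]
  simp_rw [h1]
  rw [FinProb.expect_sum]
  refine Finset.sum_le_sum fun g _ => ?_
  have := Real.concaveOn_negMulLog.le_map_sum (t := Finset.univ) (w := p.w)
    (p := fun ω => (μ ω).1.coeff g) (fun ω _ => p.nonneg ω) p.sum_eq_one
    (fun ω _ => (μ ω).nonneg g)
  have e : ∑ ω, p.w ω • (μ ω).1.coeff g = ν.1.coeff g := by
    rw [← h, AddMonoidAlgebra.coeff_sum, Finsupp.finsetSum_apply]
    simp
  rw [e] at this
  simpa [FinProb.expect] using this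

lemma H_neg (μ : Law G) : H (neg μ) = H μ := by
  rw [← law_space μ, neg_law, H_law, H_law]
  exact FinProb.ent_congr _ _ _ fun _ _ => neg_inj.symm.symm

/-- The Kaimanovich-Vershik inequality. -/
lemma H_kv (μ ν l : Law G) : H (μ * ν * l) + H l ≤ H (μ * l) + H (ν * l) := by
  let p := μ.space
  let q := ν.space
  let r := l.space
  let P := p.prod (q.prod r)
  let A : _ × _ × _ → G := fun ω : μ.1.coeff.support × ν.1.coeff.support × l.1.coeff.support => ω.1
  let B : _ × _ × _ → G := fun ω : μ.1.coeff.support × ν.1.coeff.support × l.1.coeff.support => ω.2.1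
  let C : _ × _ × _ → G := fun ω : μ.1.coeff.support × ν.1.coeff.support × l.1.coeff.support => ω.2.2
  have h1 : P.ent (fun ω => (A ω, B ω, C ω)) = H μ + (H ν + H l) := by
    conv_rhs => rw [← law_space μ, ← law_space ν, ← law_space l, H_law, H_law, H_law]
    rw [← FinProb.ent_prod, ← FinProb.ent_prod]
  have h2 : P.law (fun ω => A ω + (B ω + C ω)) = μ * (ν * l) := by
    conv_rhs => rw [← law_space μ, ← law_space ν, ← law_space l]
    rw [← FinProb.law_add_prod, ← FinProb.law_add_prod]
  have h3 : P.law (fun ω => A ω + C ω) = μ * l := by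
    conv_rhs => rw [← law_space μ, ← law_space l]
    rw [← (FinProb.isPush_snd q r).law, ← FinProb.law_add_prod]
  have h4 : P.law (fun ω => B ω + C ω) = ν * l := by
    conv_rhs => rw [← law_space ν, ← law_space l]
    rw [← FinProb.law_add_prod, ← (FinProb.isPush_snd p (q.prod r)).law]
  have h5 : P.law A = μ := by
    conv_rhs => rw [← law_space μ]
    rw [← (FinProb.isPush_fst p (q.prod r)).law]
  have h6 : P.law B = ν := by
    conv_rhs => rw [← law_space ν]
    rw [← (FinProb.isPush_fst q r).law, ← (FinProb.isPush_snd p (q.prod r)).law]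
  rw [mul_assoc, ← h2, ← h3, ← h4, H_law, H_law, H_law]
  have k1 := P.ent_pair_le (fun ω => A ω + C ω) B
  have k2 := P.ent_pair_le A (fun ω => B ω + C ω)
  -- Each of the two pairs determines A + B + C, and together they determine the triple.
  have k3 := P.ent_submodular (fun ω => (A ω + C ω, B ω)) (fun ω => (A ω, B ω + C ω))
    (fun ω => (A ω, B ω, C ω)) (fun ω => A ω + (B ω + C ω))
    (fun ω ω' h => by
      rw [Prod.mk.injEq] at h
      rw [add_left_comm, h.1, h.2, add_left_comm])
    (fun ω ω' h => by
      rw [Prod.mk.injEq] at h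
      rw [h.1, h.2])
    (fun ω ω' h h' => by
      rw [Prod.mk.injEq] at h h'
      have := h.1
      rw [h'.1, add_right_inj] at this
      simp [h'.1, h.2, this])
  have e1 : P.ent A = H μ := (H_law P A).symm.trans (congrArg H h5)
  have e2 : P.ent B = H ν := (H_law P B).symm.trans (congrArg H h6)
  linarith

/-- A Ruzsa triangle inequality in which the two outer variables may be dependent. -/
lemma H_triangle_dependent (p : FinProb Ω) (A B : Ω → G) (l : Law G) :
    p.ent (fun ω => A ω - B ω) + H l ≤ H (p.law A * neg l) + H (l * neg (p.law B)) := by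
  let r := l.space
  let P := p.prod r
  have h1 : P.ent (fun ω => ((A ω.1, B ω.1), (ω.2 : G))) = p.ent (fun ω => (A ω, B ω)) + H l := by
    conv_rhs => rw [← law_space l, H_law]
    rw [← FinProb.ent_prod]
  have h2 : P.law (fun ω => A ω.1 + -(ω.2 : G)) = p.law A * neg l := by
    conv_rhs => rw [← law_space l]
    rw [neg_law, ← FinProb.law_add_prod]
  have h3 : P.law (fun ω => -B ω.1 + (ω.2 : G)) = l * neg (p.law B) := by
    conv_rhs => rw [← law_space l]
    rw [neg_law, mul_comm, ← FinProb.law_add_prod]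
  rw [← h2, ← h3, H_law, H_law]
  have k0 := P.ent_pair_le (fun ω => A ω.1 + -(ω.2 : G)) (fun ω => -B ω.1 + (ω.2 : G))
  -- A - B = (A - L) + (L - B) is a function of either pair. Only the independence of L from (A, B)
  -- matters.
  have k1 := P.ent_submodular
    (fun ω => (A ω.1 + -(ω.2 : G), -B ω.1 + (ω.2 : G))) (fun ω => (A ω.1, B ω.1))
    (fun ω => ((A ω.1, B ω.1), (ω.2 : G))) (fun ω => A ω.1 - B ω.1)
    (fun ω ω' h => by
      rw [Prod.mk.injEq] at h
      have e : ∀ ω : Ω × l.1.coeff.support,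
        A ω.1 - B ω.1 = (A ω.1 + -(ω.2 : G)) + (-B ω.1 + (ω.2 : G)) := fun ω => by abel
      rw [e, e, h.1, h.2])
    (fun ω ω' h => by
      rw [Prod.mk.injEq] at h
      rw [h.1, h.2])
    (fun ω ω' h h' => by
      rw [Prod.mk.injEq] at h h'
      have := h.2
      rw [h'.2, add_right_inj] at this
      simp [h'.1, h'.2, this])
  rw [(FinProb.isPush_fst p r).ent (fun ω => (A ω, B ω)),
    (FinProb.isPush_fst p r).ent (fun ω => A ω - B ω)] at k1
  linarith

lemma H_triangle (μ ν l : Law G) : H (μ * neg ν) + H l ≤ H (μ * neg l) + H (l * neg ν) := by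
  have := H_triangle_dependent (μ.space.prod ν.space) (fun ω => (ω.1 : G)) (fun ω => (ω.2 : G)) l
  rw [(FinProb.isPush_fst μ.space ν.space).law (fun g => (g : G)),
    (FinProb.isPush_snd μ.space ν.space).law (fun g => (g : G)), law_space, law_space] at this
  refine le_trans (le_of_eq ?_) this
  congr 1
  conv_lhs => rw [← law_space μ, ← law_space ν]
  rw [neg_law, ← FinProb.law_add_prod, H_law]
  simp [sub_eq_add_neg]

lemma law_prod_space (μ ν : Law G) :
    (μ.space.prod ν.space).law (fun ω => (ω.1 : G) + (ω.2 : G)) = μ * ν := by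
  conv_rhs => rw [← law_space μ, ← law_space ν]
  rw [← FinProb.law_add_prod]

/-- For independent A, B, H[A] + H[B] = H[A, B] ≤ H[A + B, B] ≤ H[A + B] + H[B]. -/
lemma H_le_mul_right (μ ν : Law G) : H μ ≤ H (μ * ν) := by
  let P := μ.space.prod ν.space
  have h1 : P.ent (fun ω => ((ω.1 : G), (ω.2 : G))) = H μ + H ν := by
    conv_rhs => rw [← law_space μ, ← law_space ν, H_law, H_law]
    rw [← FinProb.ent_prod]
  have h2 := P.ent_pair_le (fun ω => (ω.1 : G) + (ω.2 : G)) (fun ω => (ω.2 : G))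
  have e1 : P.ent (fun ω => (ω.1 : G) + (ω.2 : G)) = H (μ * ν) := by rw [← H_law, law_prod_space]
  have e2 : P.ent (fun ω => (ω.2 : G)) = H ν := by
    rw [(FinProb.isPush_snd μ.space ν.space).ent (fun g => (g : G)), ← H_law, law_space]
  have h3 := P.ent_le_of_determines (fun ω => ((ω.1 : G) + (ω.2 : G), (ω.2 : G)))
    (fun ω => ((ω.1 : G), (ω.2 : G))) (fun ω ω' h => by
      rw [Prod.mk.injEq] at h
      have := h.1
      rw [h.2, add_left_inj] at this
      simp [this, h.2])
  linarith

/-- The triangle inequality is applied to the dependent pair A + B and -nB, whose difference is A +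
(n + 1)B, with a fresh copy of A in the middle. -/
lemma H_mul_dil_succ (μ ν : Law G) (n : ℕ) :
    H (μ * dil (n + 1) ν) + H μ ≤ H (μ * ν * neg μ) + H (μ * dil n ν) := by
  let P := μ.space.prod ν.space
  have h := H_triangle_dependent P (fun ω => (ω.1 : G) + (ω.2 : G)) (fun ω => -(n • (ω.2 : G))) μ
  have e : P.law (fun ω => -(n • (ω.2 : G))) = neg (dil n ν) := by
    conv_rhs => rw [← law_space ν]
    rw [dil_law, neg_law, ← (FinProb.isPush_snd μ.space ν.space).law]
  rw [e, neg_neg, law_prod_space] at h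
  refine le_trans (le_of_eq ?_) h
  congr 1
  conv_lhs => rw [← law_space μ, ← law_space ν]
  rw [dil_law, ← FinProb.law_add_prod, H_law]
  congr 1
  funext ω
  rw [succ_nsmul']
  abel

end Law
end Law

/-! ### Multidistance and its control of doubling. -/

namespace Law

variable {G : Type*} [AddCommGroup G] {ι : Type*} [Fintype ι]

/-- The entropic Ruzsa distance of two laws. -/
noncomputable def dist (μ ν : Law G) : ℝ := H (μ * neg ν) - 1 / 2 * H μ - 1 / 2 * H ν

/-- The multidistance of a tuple of laws. -/
noncomputable def multidist (μ : ι → Law G) : ℝ :=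
  H (∏ i, μ i) - 1 / (Fintype.card ι : ℝ) * ∑ i, H (μ i)

lemma H_neg_mul_neg (μ ν : Law G) : H (neg μ * neg ν) = H (μ * ν) := by
  rw [← map_mul, H_neg]

/-- Kaimanovich-Vershik lets the summands be attached to `l` one at a time. -/
lemma H_mul_prod_le {κ : Type*} (l : Law G) (ν : κ → Law G) (s : Finset κ) :
    H (l * ∏ i ∈ s, ν i) ≤ H l + ∑ i ∈ s, (H (l * ν i) - H l) := by
  classical
  induction s using Finset.induction_on with
  | empty => simp
  | insert a s ha ih =>
    rw [Finset.prod_insert ha, Finset.sum_insert ha]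
    have := H_kv (ν a) (∏ i ∈ s, ν i) l
    rw [mul_comm (ν a * _) l, mul_comm (ν a) l, mul_comm _ l] at this
    linarith

lemma H_pow_succ_le (l : Law G) (n : ℕ) : H (l ^ (n + 1)) ≤ H l + n * (H (l * l) - H l) := by
  have := H_mul_prod_le l (fun _ : Fin n => l) Finset.univ
  simp only [Finset.prod_const, Finset.sum_const, Finset.card_univ, Fintype.card_fin,
    nsmul_eq_mul] at this
  rwa [pow_succ']

lemma H_mul_neg_self_le (l : Law G) : H (l * neg l) + H l ≤ 2 * H (l * l) := by
  have := H_triangle l l (neg l)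
  rw [neg_neg, H_neg, H_neg_mul_neg] at this
  linarith

/-- Raising the dilation factor by one costs H[L + L' - L''] - H[L], at most twice the growth under
differences, hence at most four times the growth under sums. -/
lemma H_mul_dil_le (l : Law G) (n : ℕ) :
    H (l * dil n l) ≤ H l + n * (4 * (H (l * l) - H l)) := by
  induction n with
  | zero => simp [dil_zero]
  | succ n ih =>
    have h1 := H_mul_dil_succ l l n
    have h2 := H_kv l l (neg l)
    rw [H_neg] at h2
    have h3 := H_mul_neg_self_le l
    push_cast
    linarith

lemma multidist_const_le {m : ℕ} (hm : m ≠ 0) (U : Law G) :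
    multidist (fun _ : Fin m => U) ≤ (m - 1) * (H (U * U) - H U) := by
  obtain ⟨n, rfl⟩ := Nat.exists_eq_succ_of_ne_zero hm
  have := H_pow_succ_le U n
  simp only [multidist, Finset.prod_const, Finset.sum_const, Finset.card_univ, Fintype.card_fin,
    nsmul_eq_mul, Nat.succ_eq_add_one]
  have h : (1 : ℝ) / ((n + 1 : ℕ) : ℝ) * (((n + 1 : ℕ) : ℝ) * H U) = H U := by
    field_simp
  rw [h]
  push_cast
  linarith

lemma H_prod_le_of_subset (μ : ι → Law G) (s : Finset ι) : H (∏ i ∈ s, μ i) ≤ H (∏ i, μ i) := by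
  classical
  rw [← Finset.prod_mul_prod_compl s]
  exact H_le_mul_right _ _

lemma H_le_prod (μ : ι → Law G) (i : ι) : H (μ i) ≤ H (∏ i, μ i) := by
  simpa using H_prod_le_of_subset μ {i}

lemma multidist_nonneg (μ : ι → Law G) [Nonempty ι] : 0 ≤ multidist μ := by
  rw [multidist, sub_nonneg, one_div, inv_mul_le_iff₀ (by positivity)]
  refine (Finset.sum_le_sum fun i _ => H_le_prod μ i).trans ?_
  simp

lemma H_pair_le_prod (μ : ι → Law G) {i j : ι} (hij : i ≠ j) :
    H (μ i * μ j) ≤ H (∏ i, μ i) := by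
  classical
  simpa [Finset.prod_pair hij] using H_prod_le_of_subset μ {i, j}

/-- The triangle inequality passes through the reflection of a second member of the tuple; a sum of
two members has at most the entropy of the full sum. -/
lemma dist_self_le (μ : ι → Law G) {i j : ι} (hij : i ≠ j) :
    dist (μ i) (μ i) ≤ 2 * H (∏ i, μ i) - H (μ i) - H (μ j) := by
  have h := H_triangle (μ i) (μ i) (neg (μ j))
  rw [neg_neg, H_neg, H_neg_mul_neg, mul_comm (μ j)] at h
  have := H_pair_le_prod μ hij
  rw [dist]
  linarith

/-- Kaimanovich-Vershik with common summand X_j: the extra copy of X_i and the remaining members are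
attached to it separately. -/
lemma H_mul_prod_self_le (μ : ι → Law G) {i j : ι} (hij : i ≠ j) :
    H (μ i * ∏ i, μ i) ≤ 2 * H (∏ i, μ i) - H (μ j) := by
  classical
  have h := H_kv (μ i) (∏ a ∈ Finset.univ.erase j, μ a) (μ j)
  rw [mul_assoc, Finset.prod_erase_mul _ _ (Finset.mem_univ j)] at h
  have := H_pair_le_prod μ hij
  linarith

/-- One copy of the full sum is split as X_i + R, and X_i and R are attached separately to the other
copy. Attaching R is bounded by a second use of Kaimanovich-Vershik, with X_i as the common summand.
-/
lemma H_prod_mul_prod_le (μ : ι → Law G) {i j : ι} (hij : i ≠ j) :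
    H ((∏ i, μ i) * ∏ i, μ i) ≤ 3 * H (∏ i, μ i) - H (μ i) - H (μ j) := by
  classical
  have e := Finset.mul_prod_erase Finset.univ μ (Finset.mem_univ i)
  set R := ∏ a ∈ Finset.univ.erase i, μ a
  have h := H_kv (μ i) R (∏ i, μ i)
  have h1 := H_kv R R (μ i)
  have h2 := H_mul_prod_self_le μ hij
  rw [mul_assoc, mul_comm R (μ i), e] at h1
  rw [e] at h
  linarith

section Perm

variable (μ : ι → Law G) (τ : Equiv.Perm ι) (hτ : ∀ i, τ i ≠ i)

lemma card_mul_multidist [Nonempty ι] : (Fintype.card ι : ℝ) * multidist μ =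
    Fintype.card ι * H (∏ i, μ i) - ∑ i, H (μ i) := by
  rw [multidist, mul_sub, ← mul_assoc, mul_one_div_cancel (by positivity), one_mul]

lemma multidist_comp_perm (σ : Equiv.Perm ι) : multidist (fun i => μ (σ i)) = multidist μ := by
  rw [multidist, multidist, Equiv.prod_comp σ μ, Equiv.sum_comp σ fun i => H (μ i)]

include hτ

/-- The derangement gives each i a partner τ i ≠ i. As τ permutes the indices, summing the pairwise
bounds subtracts twice the total entropy, which is what turns them into the multidistance; the next
estimates average in the same way. -/
lemma sum_dist_self_le [Nonempty ι] :
    ∑ i, dist (μ i) (μ i) ≤ 2 * Fintype.card ι * multidist μ := by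
  have h := Finset.sum_le_sum fun i (_ : i ∈ Finset.univ) => dist_self_le μ (hτ i).symm
  rw [Finset.sum_sub_distrib, Finset.sum_sub_distrib, Equiv.sum_comp τ fun i => H (μ i)] at h
  have := card_mul_multidist μ
  simp only [Finset.sum_const, Finset.card_univ, nsmul_eq_mul] at h
  linarith

lemma H_sq_le [Nonempty ι] :
    H ((∏ i, μ i) * ∏ i, μ i) ≤ H (∏ i, μ i) + 2 * multidist μ := by
  have h := Finset.sum_le_sum fun i (_ : i ∈ Finset.univ) => H_prod_mul_prod_le μ (hτ i).symm
  rw [Finset.sum_sub_distrib, Finset.sum_sub_distrib, Equiv.sum_comp τ fun i => H (μ i)] at h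
  have := card_mul_multidist μ
  simp only [Finset.sum_const, Finset.card_univ, nsmul_eq_mul] at h
  have hc : (0 : ℝ) < Fintype.card ι := by positivity
  refine le_of_mul_le_mul_left ?_ hc
  linarith

lemma H_pow_le [Nonempty ι] (n : ℕ) :
    H ((∏ i, μ i) ^ (n + 1)) ≤ H (∏ i, μ i) + 2 * n * multidist μ := by
  have h1 := H_pow_succ_le (∏ i, μ i) n
  have h2 := mul_le_mul_of_nonneg_left (H_sq_le μ τ hτ) (Nat.cast_nonneg (α := ℝ) n)
  linarith

lemma H_mul_prod_dil_le [Nonempty ι] (m : ℕ) :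
    H ((∏ i, μ i) * ∏ j : Fin m, dil j (∏ i, μ i)) ≤
      H (∏ i, μ i) + 4 * (m : ℝ) ^ 2 * multidist μ := by
  have h := H_mul_prod_le (∏ i, μ i) (fun j : Fin m => dil j (∏ i, μ i)) Finset.univ
  have hD := multidist_nonneg μ
  -- The factor 8 is 4 per dilation step times the doubling bound 2D of the full sum.
  have h1 : ∀ j : Fin m, H ((∏ i, μ i) * dil j (∏ i, μ i)) - H (∏ i, μ i) ≤
      ((j : ℕ) : ℝ) * (8 * multidist μ) := by
    intro j
    have h1 := H_mul_dil_le (∏ i, μ i) j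
    have h2 := mul_le_mul_of_nonneg_left (H_sq_le μ τ hτ) (Nat.cast_nonneg (α := ℝ) j)
    linarith
  have h2 := Finset.sum_le_sum fun j (_ : j ∈ Finset.univ) => h1 j
  rw [← Finset.sum_mul, Fin.sum_univ_eq_sum_range (fun j => (j : ℝ))] at h2
  have h3 : (∑ j ∈ Finset.range m, (j : ℝ)) * 2 ≤ (m : ℝ) ^ 2 := by
    have := Finset.sum_range_id_mul_two m
    have h4 : (∑ j ∈ Finset.range m, j) * 2 ≤ m ^ 2 := by
      rw [this, sq]; exact Nat.mul_le_mul_left _ (Nat.sub_le _ _)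
    rw [← Nat.cast_sum]
    exact_mod_cast h4
  have h5 := mul_le_mul_of_nonneg_right h3 (mul_nonneg zero_le_four hD)
  linarith

/-- The triangle inequality passes through the reflected full sum of the tuple. With m the array
size, the sum of dilates is the law of Z₂. -/
lemma sum_H_mul_neg_prod_dil_le [Nonempty ι] (m : ℕ) :
    ∑ i, H (μ i * neg (∏ j : Fin m, dil j (∏ i, μ i))) ≤
      Fintype.card ι * (H (∏ i, μ i) + (1 + 4 * (m : ℝ) ^ 2) * multidist μ) := by
  have h1 : ∀ i, H (μ i * neg (∏ j : Fin m, dil j (∏ i, μ i))) ≤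
      2 * H (∏ i, μ i) + 4 * (m : ℝ) ^ 2 * multidist μ - H (μ (τ i)) := by
    intro i
    have h := H_triangle (μ i) (∏ j : Fin m, dil j (∏ i, μ i)) (neg (∏ i, μ i))
    rw [neg_neg, H_neg_mul_neg, H_neg] at h
    have h2 := H_mul_prod_dil_le μ τ hτ m
    have h3 := H_mul_prod_self_le μ (hτ i).symm
    linarith
  have h2 := Finset.sum_le_sum fun j (_ : j ∈ Finset.univ) => h1 j
  rw [Finset.sum_sub_distrib, Equiv.sum_comp τ fun i => H (μ i)] at h2
  have := card_mul_multidist μ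
  simp only [Finset.sum_const, Finset.card_univ, nsmul_eq_mul] at h2
  linarith

end Perm

lemma H_le_prod_dil (l : Law G) {m : ℕ} (hm : 2 ≤ m) : H l ≤ H (∏ j : Fin m, dil j l) := by
  have := H_le_prod (fun j : Fin m => dil j l) ⟨1, hm⟩
  rwa [show ((⟨1, hm⟩ : Fin m) : ℕ) = 1 from rfl, dil_one] at this

/-- Averaging the distance to `μ` over the conditionings of `X` on the values of `V`. -/
lemma expect_dist_cond_le {Ω β : Type*} [Fintype Ω] (p : FinProb Ω) (V : Ω → β) (X : Ω → G)
    (μ : Law G) :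
    p.expect (fun ω => dist μ ((p.cond V (V ω)).law X)) ≤
      H (μ * neg (p.law X)) - 1 / 2 * H μ
        - 1 / 2 * (p.ent (fun ω => (X ω, V ω)) - p.ent V) := by
  -- Convolution with `μ` and reflection are linear, so concavity of entropy applies to the averaged
  -- laws.
  have h1 : p.expect (fun ω => H (μ * neg ((p.cond V (V ω)).law X))) ≤
      H (μ * neg (p.law X)) := by
    refine expect_H_le p _ _ ?_
    simp only [Submonoid.coe_mul, neg, map_val]
    rw [← p.law_cond_average V X, map_sum, Finset.mul_sum]
    refine Finset.sum_congr rfl fun ω _ => ?_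
    have : ∀ (f : G →+ G) (c : ℝ) (x : AddMonoidAlgebra ℝ G),
        AddMonoidAlgebra.mapDomainRingHom ℝ f (c • x) =
          c • AddMonoidAlgebra.mapDomainRingHom ℝ f x := fun f c x =>
      map_smul (AddMonoidAlgebra.mapDomainAlgHom ℝ ℝ f) c x
    rw [this, mul_smul_comm]
  have h2 := p.expect_ent_cond V X
  simp only [dist, FinProb.expect_sub, FinProb.expect_const, FinProb.expect_const_mul, H_law]
  rw [h2]
  linarith

end Law

/-! ### Independence of subtuples and conditioning of products. -/

namespace FinProb

variable {Ω : Type*} [Fintype Ω] {α β γ δ : Type*} (p : FinProb Ω)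

/-- If the entropy of a finite tuple is the sum of the entropies of its members, then functions of
complementary subtuples are independent. -/
lemma ent_add_le_of_compl {κ : Type*} [Fintype κ] (Z : κ → Ω → α)
    (h : ∑ a, p.ent (Z a) ≤ p.ent (fun ω a => Z a ω)) (s : κ → Prop) (A : Ω → β) (B : Ω → γ)
    (hA : ∀ ω ω', (∀ a, s a → Z a ω = Z a ω') → A ω = A ω')
    (hB : ∀ ω ω', (∀ a, ¬ s a → Z a ω = Z a ω') → B ω = B ω') :
    p.ent A + p.ent B ≤ p.ent (fun ω => (A ω, B ω)) := by
  classical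
  let t : Finset κ := Finset.univ.filter s
  refine p.ent_add_le_of_indep (fun ω (a : t) => Z a ω) (fun ω (a : (tᶜ : Finset κ)) => Z a ω) A B ?_
    (fun ω ω' h => hA ω ω' fun a ha => congrFun h ⟨a, by simp [t, ha]⟩)
    (fun ω ω' h => hB ω ω' fun a ha => congrFun h ⟨a, by simp [t, ha]⟩)
  have h1 := p.ent_pi_le Z t
  have h2 := p.ent_pi_le Z tᶜ
  have h3 := Finset.sum_add_sum_compl t fun a => p.ent (Z a)
  have h4 : p.ent (fun ω a => Z a ω) ≤
      p.ent (fun ω => (fun (a : t) => Z a ω, fun (a : (tᶜ : Finset κ)) => Z a ω)) := by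
    refine p.ent_le_of_determines _ _ fun ω ω' h => ?_
    rw [Prod.mk.injEq] at h
    funext a
    by_cases ha : a ∈ t
    · exact congrFun h.1 ⟨a, ha⟩
    · exact congrFun h.2 ⟨a, Finset.mem_compl.2 ha⟩
  linarith

section Pi

variable {ι : Type*} [Fintype ι] [DecidableEq ι] {B : Type*} [Fintype B]

lemma ext_w {p q : FinProb Ω} (h : ∀ ω, p.w ω = q.w ω) : p = q := by
  cases p; cases q; congr; exact funext h

lemma pi_cond (q : ι → FinProb B) (Y : B → α) (y : ι → α) (hy : ∀ i, (q i).pr Y (y i) ≠ 0) :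
    (pi q).cond (fun ω i => Y (ω i)) y = pi (fun i => (q i).cond Y (y i)) := by
  classical
  have h := pi_pr q (fun _ => Y) y
  have h0 : (pi q).pr (fun ω i => Y (ω i)) y ≠ 0 := by
    rw [h]; exact Finset.prod_ne_zero_iff.2 fun i _ => hy i
  refine ext_w fun ω => ?_
  rw [cond_w _ _ h0, h]
  simp only [pi, cond_w _ _ (hy _)]
  by_cases hω : ∀ i, Y (ω i) = y i
  · rw [if_pos (funext hω), ← Finset.prod_div_distrib]
    exact Finset.prod_congr rfl fun i _ => (if_pos (hω i)).symm
  · rw [if_neg fun h' => hω fun i => congrFun h' i]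
    push Not at hω
    obtain ⟨i, hi⟩ := hω
    exact (Finset.prod_eq_zero (Finset.mem_univ i) (by simp [hi])).symm

/-- Conditioning each coordinate on its own `Y` keeps the coordinates independent, so this is the
chain rule for the sum given all the `Y`'s. -/
lemma expect_H_prod_cond {G : Type*} [AddCommGroup G] (q : ι → FinProb B) (Y : B → α) (X : B → G) :
    (pi q).expect (fun ω => Law.H (∏ i, ((q i).cond Y (Y (ω i))).law X)) =
      (pi q).ent (fun ω => (∑ i, X (ω i), fun i => Y (ω i))) - (pi q).ent (fun ω i => Y (ω i)) := by
  rw [← expect_ent_cond]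
  refine expect_congr _ fun ω hω => ?_
  rw [pi_cond q Y (fun i => Y (ω i)), ← Law.H_law, law_sum_pi]
  intro i
  rw [← (isPush_eval q i).pr]
  exact (pr_pos _ (fun ω : ι → B => Y (ω i)) hω).ne'

lemma ent_pi_coord (q : ι → FinProb B) :
    ∑ i, (pi q).ent (fun ω => ω i) = (pi q).ent (fun ω i => ω i) := by
  rw [ent_pi q (fun _ b => b)]
  exact Finset.sum_congr rfl fun i _ => (isPush_eval q i).ent fun b => b

end Pi

end FinProb

/-! ### Near-minimizers of the multidistance. -/

namespace Law

variable {G : Type*} [AddCommGroup G]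

/-- The law is supported in `T`. -/
def SupportedIn (μ : Law G) (T : Set G) : Prop := ∀ g, μ.1.coeff g ≠ 0 → g ∈ T

lemma supportedIn_law {Ω : Type*} [Fintype Ω] (p : FinProb Ω) (X : Ω → G) {T : Set G}
    (h : ∀ ω, X ω ∈ T) : SupportedIn (p.law X) T := by
  classical
  intro g hg
  rw [FinProb.law_coeff, FinProb.pr] at hg
  obtain ⟨ω, -, h'⟩ := Finset.exists_ne_zero_of_sum_ne_zero hg
  by_contra h''
  refine h' (if_neg ?_)
  rintro rfl
  exact h'' (h ω)

variable {ι : Type*} [Fintype ι]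

/-- No tuple of laws supported in `T` decrements the multidistance, compared to the value `k`, by the
factor `η`, with a penalty for the distance to the tuple `μ`. -/
def NearMin (T : Set G) (η k : ℝ) (μ : ι → Law G) : Prop :=
  ∀ μ' : ι → Law G, (∀ i, SupportedIn (μ' i) T) →
    (1 - η) * k - η * ∑ i, dist (μ i) (μ' i) ≤ multidist μ'

lemma NearMin.comp_perm {T : Set G} {η k : ℝ} {μ : ι → Law G} (h : NearMin T η k μ)
    (σ : Equiv.Perm ι) : NearMin T η k (fun i => μ (σ i)) := by
  intro μ' hμ'
  have := h (fun i => μ' (σ.symm i)) fun i => hμ' _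
  rw [multidist_comp_perm, ← Equiv.sum_comp σ] at this
  simpa using this

end Law

/-! ### A fibring inequality for arrays. -/

section Array

open FinProb

variable {G : Type*} [AddCommGroup G] {ι : Type*} [Fintype ι] [DecidableEq ι] {F : Type*} {n : ℕ}

/-- The sum of the entries of a row from the `j`-th one on. -/
def tailSum (v : F → G) (j : ℕ) (b : Fin (n + 1) → F) : G :=
  ∑ l ∈ Finset.univ.filter (fun l : Fin (n + 1) => j ≤ l), v (b l)

lemma tailSum_zero (v : F → G) (b : Fin (n + 1) → F) : tailSum v 0 b = ∑ l, v (b l) := by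
  simp [tailSum]

lemma tailSum_eq_add (v : F → G) (j : Fin (n + 1)) (b : Fin (n + 1) → F) :
    tailSum v j b = v (b j) + tailSum v (j + 1) b := by
  classical
  rw [tailSum, tailSum, ← Finset.sum_insert (a := j) (f := fun l => v (b l)) (by simp)]
  congr 1
  ext l
  simp only [Finset.mem_filter, Finset.mem_univ, true_and, Finset.mem_insert, Fin.ext_iff]
  omega

lemma tailSum_last (v : F → G) (b : Fin (n + 1) → F) : tailSum v n b = v (b (Fin.last n)) := by
  have := tailSum_eq_add v (Fin.last n) b
  rw [Fin.val_last] at this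
  rw [this, tailSum, Finset.filter_false_of_mem, Finset.sum_empty, add_zero]
  intro l _
  have := l.2
  omega

lemma tailSum_add_head (v : F → G) (j : ℕ) (b : Fin (n + 1) → F) :
    ∑ l ∈ Finset.univ.filter (fun l : Fin (n + 1) => ¬ j ≤ l), v (b l) + tailSum v j b
      = ∑ l, v (b l) := by
  rw [tailSum, add_comm]
  exact Finset.sum_filter_add_sum_filter_not _ _ _

variable [Fintype F]

/-- The law of an array with independent entries. -/
def arrayProb (q : ι → Fin (n + 1) → FinProb F) : FinProb (ι → Fin (n + 1) → F) :=
  pi fun i => pi (q i)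

variable (q : ι → Fin (n + 1) → FinProb F) (v : F → G)

lemma array_total : ∑ a : ι × Fin (n + 1), (arrayProb q).ent (fun ω => ω a.1 a.2) ≤
    (arrayProb q).ent (fun ω (a : ι × Fin (n + 1)) => ω a.1 a.2) := by
  rw [Fintype.sum_prod_type]
  have h1 : ∀ i j, (arrayProb q).ent (fun ω => ω i j) = (pi (q i)).ent (fun b => b j) := fun i j =>
    (isPush_eval (fun i => pi (q i)) i).ent fun b => b j
  simp_rw [h1, ent_pi_coord]
  rw [← ent_pi (fun i => pi (q i)) (fun _ b j => b j)]
  refine ent_le_of_determines _ _ _ fun ω ω' h => ?_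
  funext i j
  exact congrFun h (i, j)

/-- One step of the chain rule for the column sums given the row sums. -/
lemma array_step (k : Fin (n + 1)) :
    (arrayProb q).ent (fun ω => ((fun (j : {j : Fin (n + 1) // (j : ℕ) < k}) => ∑ i, v (ω i j)),
        fun i => ∑ j, v (ω i j))) +
      ((arrayProb q).ent (fun ω => (∑ i, v (ω i k), fun i => tailSum v k (ω i))) -
        (arrayProb q).ent (fun ω i => tailSum v k (ω i))) ≤
    (arrayProb q).ent (fun ω => ((fun (j : {j : Fin (n + 1) // (j : ℕ) < k + 1}) => ∑ i, v (ω i j)),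
        fun i => ∑ j, v (ω i j))) := by
  let p := arrayProb q
  let C : (ι → Fin (n + 1) → F) → G := fun ω => ∑ i, v (ω i k)
  let R : (ι → Fin (n + 1) → F) → ι → G := fun ω i => ∑ j, v (ω i j)
  let P : (ι → Fin (n + 1) → F) → ι → G := fun ω i => tailSum v k (ω i)
  let x : (ι → Fin (n + 1) → F) → {a : ι × Fin (n + 1) // (a.2 : ℕ) < k} → F :=
    fun ω a => ω a.1.1 a.1.2
  have hx : ∀ ω ω', x ω = x ω' → ∀ i (j : Fin (n + 1)), ¬ (k : ℕ) ≤ j → ω i j = ω' i j :=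
    fun ω ω' h i j hj => congrFun h ⟨(i, j), by simpa using hj⟩
  have hxs : ∀ ω ω', x ω = x ω' → ∀ i,
      ∑ l ∈ Finset.univ.filter (fun l : Fin (n + 1) => ¬ (k : ℕ) ≤ l), v (ω i l) =
      ∑ l ∈ Finset.univ.filter (fun l : Fin (n + 1) => ¬ (k : ℕ) ≤ l), v (ω' i l) := by
    intro ω ω' h i
    refine Finset.sum_congr rfl fun l hl => ?_
    rw [hx ω ω' h i l (Finset.mem_filter.1 hl).2]
  -- Conditioning on all entries of the earlier columns, rather than on their column sums, can only
  -- lower the entropy of the `k`-th column sum.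
  have h1 := p.ent_submodular
    (fun ω => ((fun (j : {j : Fin (n + 1) // (j : ℕ) < k + 1}) => ∑ i, v (ω i j)), R ω))
    (fun ω => (x ω, R ω)) (fun ω => (C ω, x ω, R ω))
    (fun ω => ((fun (j : {j : Fin (n + 1) // (j : ℕ) < k}) => ∑ i, v (ω i j)), R ω))
    (fun ω ω' h => by
      rw [Prod.mk.injEq] at h
      refine Prod.ext ?_ h.2
      funext j
      exact congrFun h.1 ⟨j.1, j.2.trans (Nat.lt_succ_self _)⟩)
    (fun ω ω' h => by
      rw [Prod.mk.injEq] at h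
      refine Prod.ext ?_ h.2
      funext j
      refine Finset.sum_congr rfl fun i _ => ?_
      rw [hx ω ω' h.1 i j (not_le.2 j.2)])
    (fun ω ω' h h' => by
      rw [Prod.mk.injEq] at h h'
      have : C ω = C ω' := congrFun h.1 ⟨k, Nat.lt_succ_self _⟩
      simp [this, h'.1, h'.2])
  -- Once the earlier entries are known, row sums and tail sums carry the same information, and the
  -- tail sums are independent of those entries.
  have h2 : p.ent x + p.ent (fun ω => (C ω, P ω)) ≤ p.ent (fun ω => (x ω, C ω, P ω)) := by
    refine p.ent_add_le_of_compl (fun (a : ι × Fin (n + 1)) ω => ω a.1 a.2) (array_total q)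
      (fun a => (a.2 : ℕ) < k) x _ ?_ ?_
    · intro ω ω' h
      funext a
      exact h a.1 a.2
    · intro ω ω' h
      have h' : ∀ i (l : Fin (n + 1)), (k : ℕ) ≤ l → ω i l = ω' i l := fun i l hl =>
        h (i, l) (not_lt.2 hl)
      refine Prod.ext ?_ ?_
      · exact Finset.sum_congr rfl fun i _ => by rw [h' i k le_rfl]
      · funext i
        change tailSum v k (ω i) = tailSum v k (ω' i)
        rw [tailSum, tailSum]
        refine Finset.sum_congr rfl fun l hl => ?_
        rw [h' i l (Finset.mem_filter.1 hl).2]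
  have h3 : p.ent (fun ω => (x ω, C ω, P ω)) ≤ p.ent (fun ω => (C ω, x ω, R ω)) := by
    refine p.ent_le_of_determines _ _ fun ω ω' h => ?_
    simp only [Prod.mk.injEq] at h
    have : P ω = P ω' := by
      funext i
      have e := congrFun h.2.2 i
      simp only [R] at e
      rw [← tailSum_add_head v k, ← tailSum_add_head v k, hxs ω ω' h.2.1 i] at e
      exact add_left_cancel e
    simp [h.1, h.2.1, this]
  have h4 : p.ent (fun ω => (x ω, R ω)) ≤ p.ent x + p.ent P := by
    refine le_trans ?_ (p.ent_pair_le _ _)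
    refine p.ent_le_of_determines _ _ fun ω ω' h => ?_
    simp only [Prod.mk.injEq] at h
    have : R ω = R ω' := by
      funext i
      have e := congrFun h.2 i
      simp only [P] at e
      simp only [R]
      rw [← tailSum_add_head v k, ← tailSum_add_head v k, hxs ω ω' h.1 i, e]
    simp [h.1, this]
  change p.ent _ + (p.ent (fun ω => (C ω, P ω)) - p.ent P) ≤ p.ent _
  linarith

lemma array_chain (k : ℕ) (hk : k ≤ n + 1) :
    (arrayProb q).ent (fun ω i => ∑ j, v (ω i j)) +
      ∑ j : Fin k, ((arrayProb q).ent (fun ω => (∑ i, v (ω i (Fin.castLE hk j)),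
          fun i => tailSum v j (ω i))) - (arrayProb q).ent (fun ω i => tailSum v j (ω i))) ≤
    (arrayProb q).ent (fun ω => ((fun (j : {j : Fin (n + 1) // (j : ℕ) < k}) => ∑ i, v (ω i j)),
        fun i => ∑ j, v (ω i j))) := by
  induction k with
  | zero =>
    simp only [Finset.univ_eq_empty, Finset.sum_empty, add_zero]
    exact ent_le_of_determines _ _ _ fun ω ω' h => (Prod.ext_iff.1 h).2
  | succ k ih =>
    rw [Fin.sum_univ_castSucc]
    have h1 := ih (Nat.le_of_succ_le hk)
    have h2 := array_step q v ⟨k, hk⟩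
    rw [← add_assoc]
    refine le_trans (add_le_add_left h1 _) h2

/-- Fibring inequality for the row sums and the column sums of an array. -/
lemma array_mutual_information_le :
    (arrayProb q).ent (fun ω j => ∑ i, v (ω i j)) + (arrayProb q).ent (fun ω i => ∑ j, v (ω i j))
      - (arrayProb q).ent (fun ω => ((fun j => ∑ i, v (ω i j)), fun i => ∑ j, v (ω i j))) ≤
    ∑ j, (arrayProb q).ent (fun ω => ∑ i, v (ω i j)) -
      ∑ j : Fin n, ((arrayProb q).ent (fun ω => (∑ i, v (ω i j.castSucc),
          fun i => tailSum v j (ω i))) - (arrayProb q).ent (fun ω i => tailSum v j (ω i))) := by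
  -- The chain stops before the last column: there the tail sums are the entries themselves and
  -- would contribute no entropy.
  have h1 := array_chain q v n (Nat.le_succ n)
  have h2 := (arrayProb q).ent_pi_le (fun j ω => ∑ i, v (ω i j)) Finset.univ
  have h3 : (arrayProb q).ent (fun ω j => ∑ i, v (ω i j)) ≤
      (arrayProb q).ent fun ω (j : (Finset.univ : Finset (Fin (n + 1)))) => ∑ i, v (ω i j) := by
    refine ent_le_of_determines _ _ _ fun ω ω' h => ?_
    funext j
    exact congrFun h ⟨j, Finset.mem_univ _⟩
  have h4 : (arrayProb q).ent (fun ω => ((fun (j : {j : Fin (n + 1) // (j : ℕ) < n}) =>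
      ∑ i, v (ω i j)), fun i => ∑ j, v (ω i j))) ≤
      (arrayProb q).ent (fun ω => ((fun j => ∑ i, v (ω i j)), fun i => ∑ j, v (ω i j))) := by
    refine ent_le_of_determines _ _ _ fun ω ω' h => ?_
    rw [Prod.mk.injEq] at h
    refine Prod.ext ?_ h.2
    funext j
    exact congrFun h.1 j
  have h5 : ∀ j : Fin n, Fin.castLE (Nat.le_succ n) j = j.castSucc := fun j => rfl
  simp only [h5] at h1
  linarith

end Array

/-! ### Row and column sums for a near-minimizer. -/

section Array

open FinProb

variable {G : Type*} [AddCommGroup G] {ι : Type*} [Fintype ι] [DecidableEq ι] {F : Type*} [Fintype F]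
  {n : ℕ}

lemma row_law_eval (q : Fin (n + 1) → FinProb F) (v : F → G) (j : Fin (n + 1)) :
    (pi q).law (fun b => v (b j)) = (q j).law v :=
  (isPush_eval q j).law v

/-- Subtracting the entry from its tail leaves the next tail, which is independent of the entry. -/
lemma row_ent_pair_ge (q : Fin (n + 1) → FinProb F) (v : F → G) (j : Fin (n + 1)) :
    Law.H ((q j).law v) + Law.H ((pi q).law (tailSum v (j + 1))) ≤
      (pi q).ent (fun b => (v (b j), tailSum v j b)) := by
  have h := (pi q).ent_add_le_of_compl (fun l b => b l) (ent_pi_coord q).le (fun l => l = j)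
    (fun b => v (b j)) (tailSum v (j + 1))
    (fun b b' h => by rw [h j rfl])
    (fun b b' h => by
      rw [tailSum, tailSum]
      refine Finset.sum_congr rfl fun l hl => ?_
      rw [h l fun e => by
        have := (Finset.mem_filter.1 hl).2
        rw [e] at this
        omega])
  rw [← row_law_eval q v j, Law.H_law, Law.H_law]
  refine h.trans (ent_le_of_determines _ _ _ fun b b' e => ?_)
  rw [tailSum_eq_add, tailSum_eq_add, Prod.mk.injEq] at e
  have := e.2
  rw [e.1, add_right_inj] at this
  simp [e.1, this]

variable (q : ι → Fin (n + 1) → FinProb F) (v : F → G)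

/-- Near-minimality is tested on the column conditioned on the tail sums, which still takes values
in `T`, and then averaged. The differences of tail entropies are kept because they telescope over
the columns. -/
lemma array_column_ge [Nonempty ι] {T : Set G} {η k : ℝ} (hη : 0 ≤ η) (hv : ∀ f, v f ∈ T)
    (j : Fin (n + 1)) (hmin : Law.NearMin T η k (fun i => (q i j).law v)) :
    (1 - η) * k - η * ∑ i, (Law.dist ((q i j).law v) ((q i j).law v) + 1 / 2 *
        (Law.H ((pi (q i)).law (tailSum v j)) - Law.H ((pi (q i)).law (tailSum v (j + 1))))) +
      1 / (Fintype.card ι : ℝ) * ∑ i, (Law.H ((q i j).law v) +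
        Law.H ((pi (q i)).law (tailSum v (j + 1))) - Law.H ((pi (q i)).law (tailSum v j))) ≤
    (arrayProb q).ent (fun ω => (∑ i, v (ω i j), fun i => tailSum v j (ω i))) -
      (arrayProb q).ent (fun ω i => tailSum v j (ω i)) := by
  let l : ι → (Fin (n + 1) → F) → Law G := fun i b =>
    ((pi (q i)).cond (tailSum v j) (tailSum v j b)).law (fun b => v (b j))
  have h1 := expect_H_prod_cond (fun i => pi (q i)) (tailSum v j) (fun b => v (b j))
  have h2 : ∀ i, (arrayProb q).expect (fun ω => Law.H (l i (ω i))) =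
      (pi (q i)).ent (fun b => (v (b j), tailSum v j b)) -
        Law.H ((pi (q i)).law (tailSum v j)) := by
    intro i
    refine ((isPush_eval (fun i => pi (q i)) i).expect (fun b => Law.H (l i b))).trans ?_
    rw [Law.H_law, ← expect_ent_cond]
    simp only [l, Law.H_law]
  have h3 : ∀ i, (arrayProb q).expect (fun ω => Law.dist ((q i j).law v) (l i (ω i))) ≤
      Law.dist ((q i j).law v) ((q i j).law v) + 1 / 2 *
        (Law.H ((pi (q i)).law (tailSum v j)) - Law.H ((pi (q i)).law (tailSum v (j + 1)))) := by
    intro i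
    have e := (isPush_eval (fun i => pi (q i)) i).expect
      (fun b => Law.dist ((q i j).law v) (l i b))
    have h := Law.expect_dist_cond_le (pi (q i)) (tailSum v j) (fun b => v (b j)) ((q i j).law v)
    rw [row_law_eval, ← Law.H_law _ (tailSum v j)] at h
    refine e.le.trans (h.trans ?_)
    have := row_ent_pair_ge (q i) v j
    rw [Law.dist]
    linarith
  have h4 := (arrayProb q).expect_mono (f := fun ω => (1 - η) * k -
      η * ∑ i, Law.dist ((q i j).law v) (l i (ω i)))
    (g := fun ω => Law.multidist fun i => l i (ω i))
    (fun ω _ => hmin _ fun i => Law.supportedIn_law _ _ fun b => hv _)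
  simp only [Law.multidist, expect_sub, expect_const, expect_const_mul, expect_sum] at h4
  have h5 : (arrayProb q).expect (fun ω => Law.H (∏ i, l i (ω i))) = _ := h1
  rw [h5] at h4
  simp only [h2] at h4
  have h6 := mul_le_mul_of_nonneg_left (Finset.sum_le_sum fun i (_ : i ∈ Finset.univ) => h3 i) hη
  have h7 : 1 / (Fintype.card ι : ℝ) * ∑ i, (Law.H ((q i j).law v) +
        Law.H ((pi (q i)).law (tailSum v (j + 1))) - Law.H ((pi (q i)).law (tailSum v j))) ≤
      1 / (Fintype.card ι : ℝ) * ∑ i, ((pi (q i)).ent (fun b => (v (b j), tailSum v j b)) -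
        Law.H ((pi (q i)).law (tailSum v j))) := by
    refine mul_le_mul_of_nonneg_left (Finset.sum_le_sum fun i _ => ?_) (by positivity)
    have := row_ent_pair_ge (q i) v j
    linarith
  change _ ≤ (pi fun i => pi (q i)).ent _ - (pi fun i => pi (q i)).ent _
  linarith

/-- Kaimanovich-Vershik with X_j as common summand of -X_j' and of the remaining variables. -/
lemma Law.dist_prod_le {κ : Type*} [Fintype κ] (ν : κ → Law G) (j : κ) :
    Law.dist (ν j) (∏ l, ν l) ≤
      Law.dist (ν j) (ν j) + 1 / 2 * (Law.H (∏ l, ν l) - Law.H (ν j)) := by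
  classical
  have h := Law.H_kv (neg (ν j)) (∏ l ∈ Finset.univ.erase j, ν l) (ν j)
  rw [mul_assoc, Finset.prod_erase_mul _ _ (Finset.mem_univ j), mul_comm (neg (ν j)) (ν j)] at h
  rw [Law.dist, Law.dist]
  have e : Law.H (ν j * neg (∏ l, ν l)) = Law.H (neg (ν j) * ∏ l, ν l) := by
    rw [← Law.H_neg_mul_neg (neg (ν j)), neg_neg]
  rw [e]
  linarith

/-- The conditional mutual information of the row sums and the column sums of an array is small if
every column is a permutation of a near minimizer of the multidistance. -/
lemma array_mutual_information_le_of_nearMin [Nonempty ι] (μ : ι → Law G) {T : Set G} {η : ℝ}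
    (hη : 0 ≤ η) (hcard : Fintype.card ι = n + 1) (τ : Equiv.Perm ι) (hτ : ∀ i, τ i ≠ i)
    (hmin : Law.NearMin T η (Law.multidist μ) μ) (hv : ∀ f, v f ∈ T)
    (hsum : ∀ b : Fin (n + 1) → F, ∑ j, v (b j) ∈ T) (σ : Fin (n + 1) → Equiv.Perm ι)
    (hq : ∀ i j, (q i j).law v = μ (σ j i)) :
    (arrayProb q).ent (fun ω j => ∑ i, v (ω i j)) + (arrayProb q).ent (fun ω i => ∑ j, v (ω i j))
      - (arrayProb q).ent (fun ω => ((fun j => ∑ i, v (ω i j)), fun i => ∑ j, v (ω i j)))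
      - (arrayProb q).ent (fun ω => ∑ i, ∑ j, v (ω i j)) ≤
      4 * ((n : ℝ) + 1) ^ 2 * η * Law.multidist μ := by
  set k := Law.multidist μ with hk
  have hk0 : 0 ≤ k := Law.multidist_nonneg μ
  have hcardR : (Fintype.card ι : ℝ) = n + 1 := by rw [hcard]; push_cast; ring
  have hm0 : (0 : ℝ) < (n : ℝ) + 1 := by positivity
  have hD : ((n : ℝ) + 1) * k = ((n : ℝ) + 1) * Law.H (∏ i, μ i) - ∑ i, Law.H (μ i) := by
    rw [hk, ← hcardR]; exact Law.card_mul_multidist μ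
  -- the laws of the sums
  have hprod : ∀ j, ∏ i, (q i j).law v = ∏ i, μ i := fun j => by
    simp_rw [hq]; exact Equiv.prod_comp (σ j) μ
  have hHsum : ∀ j, ∑ i, Law.H ((q i j).law v) = ∑ i, Law.H (μ i) := fun j => by
    simp_rw [hq]; exact Equiv.sum_comp (σ j) fun i => Law.H (μ i)
  have hcol : ∀ j, (arrayProb q).ent (fun ω => ∑ i, v (ω i j)) = Law.H (∏ i, μ i) := fun j => by
    rw [← Law.H_law, arrayProb, law_sum_pi (fun i => pi (q i)) (fun _ b => v (b j)), ← hprod j]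
    simp only [row_law_eval]
  have hrow : ∀ i, (pi (q i)).law (tailSum v 0) = ∏ j, (q i j).law v := fun i => by
    rw [← law_sum_pi (q i) (fun _ => v)]
    congr 1
    funext b
    exact tailSum_zero v b
  have hW : (arrayProb q).ent (fun ω => ∑ i, ∑ j, v (ω i j)) =
      Law.H (∏ i, ∏ j, (q i j).law v) := by
    rw [← Law.H_law, arrayProb, law_sum_pi (fun i => pi (q i)) (fun _ b => ∑ j, v (b j))]
    congr 2
    funext i
    rw [← hrow i]
    congr 1
    funext b
    exact (tailSum_zero v b).symm
  have hWpow : ∏ i, ∏ j, (q i j).law v = (∏ i, μ i) ^ (n + 1) := by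
    rw [Finset.prod_comm]
    simp [hprod]
  have hminj : ∀ j, Law.NearMin T η k (fun i => (q i j).law v) := fun j => by
    simp_rw [hq]; exact hmin.comp_perm (σ j)
  have hdist : ∀ j, ∑ i, Law.dist ((q i j).law v) ((q i j).law v) ≤ 2 * ((n : ℝ) + 1) * k := by
    intro j
    have := Law.sum_dist_self_le μ τ hτ
    rw [hcardR] at this
    simp_rw [hq]
    rwa [Equiv.sum_comp (σ j) fun i => Law.dist (μ i) (μ i)]
  -- the contribution of the row sums
  have hlast := hminj (Fin.last n) (fun i => ∏ j, (q i j).law v) (fun i => by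
    rw [← hrow]
    exact Law.supportedIn_law _ _ fun b => by rw [tailSum_zero]; exact hsum b)
  have hlast2 : ∑ i, Law.dist ((q i (Fin.last n)).law v) (∏ j, (q i j).law v) ≤
      ∑ i, Law.dist ((q i (Fin.last n)).law v) ((q i (Fin.last n)).law v) +
        1 / 2 * (∑ i, Law.H (∏ j, (q i j).law v) - ∑ i, Law.H (μ i)) := by
    rw [← hHsum (Fin.last n), ← Finset.sum_sub_distrib, Finset.mul_sum, ← Finset.sum_add_distrib]
    exact Finset.sum_le_sum fun i _ => Law.dist_prod_le (fun j => (q i j).law v) (Fin.last n)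
  -- In this form `hlast` bounds H[W] from below; the term subtracted for conditioning on `W` thus
  -- supplies the missing `(n + 1)`-st copy of (1 - η)k.
  rw [Law.multidist, hWpow, hcardR] at hlast
  have hrowH : ∑ i, Law.H (∏ j, (q i j).law v) - ∑ i, Law.H (μ i) ≤
      ((n : ℝ) + 1) * (2 * n + 1) * k := by
    have h1 : ∀ i, Law.H (∏ j, (q i j).law v) ≤ Law.H (∏ i, μ i) + 2 * n * k := by
      intro i
      refine (Law.H_le_prod (fun i => ∏ j, (q i j).law v) i).trans ?_
      rw [hWpow]
      exact Law.H_pow_le μ τ hτ n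
    have h2 := Finset.sum_le_sum fun i (_ : i ∈ Finset.univ) => h1 i
    simp only [Finset.sum_const, Finset.card_univ, nsmul_eq_mul, hcardR] at h2
    linarith
  -- the contribution of the columns
  have hcols := Finset.sum_le_sum fun (j : Fin n) (_ : j ∈ Finset.univ) =>
    array_column_ge q v hη hv j.castSucc (hminj j.castSucc)
  have htel : ∀ i, ∑ j : Fin n, (Law.H ((pi (q i)).law (tailSum v j)) -
      Law.H ((pi (q i)).law (tailSum v (j + 1)))) =
      Law.H (∏ j, (q i j).law v) - Law.H ((q i (Fin.last n)).law v) := by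
    intro i
    rw [Fin.sum_univ_eq_sum_range (fun j => Law.H ((pi (q i)).law (tailSum v j)) -
      Law.H ((pi (q i)).law (tailSum v (j + 1)))), Finset.sum_range_sub', hrow]
    congr 2
    rw [← row_law_eval]
    congr 1
    funext b
    exact tailSum_last v b
  have hL : ∑ j : Fin n, ((1 - η) * k - η * ∑ i, (Law.dist ((q i j.castSucc).law v)
        ((q i j.castSucc).law v) + 1 / 2 * (Law.H ((pi (q i)).law (tailSum v j)) -
          Law.H ((pi (q i)).law (tailSum v (j + 1))))) +
      1 / (Fintype.card ι : ℝ) * ∑ i, (Law.H ((q i j.castSucc).law v) +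
        Law.H ((pi (q i)).law (tailSum v (j + 1))) - Law.H ((pi (q i)).law (tailSum v j)))) =
      n * ((1 - η) * k) - η * (∑ j : Fin n, ∑ i, Law.dist ((q i j.castSucc).law v)
        ((q i j.castSucc).law v) + 1 / 2 * (∑ i, Law.H (∏ j, (q i j).law v) - ∑ i, Law.H (μ i))) +
      1 / ((n : ℝ) + 1) * (n * ∑ i, Law.H (μ i) -
        (∑ i, Law.H (∏ j, (q i j).law v) - ∑ i, Law.H (μ i))) := by
    have e1 : ∑ i, Law.H (∏ j, (q i j).law v) - ∑ i, Law.H (μ i) =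
        ∑ j : Fin n, ∑ i, (Law.H ((pi (q i)).law (tailSum v j)) -
          Law.H ((pi (q i)).law (tailSum v (j + 1)))) := by
      rw [Finset.sum_comm]
      simp_rw [htel]
      rw [Finset.sum_sub_distrib, hHsum]
    have e2 : n * ∑ i, Law.H (μ i) = ∑ j : Fin n, ∑ i, Law.H ((q i j.castSucc).law v) := by
      simp [hHsum]
    rw [e1, e2, ← Finset.sum_sub_distrib, hcardR, Finset.mul_sum (a := (1 : ℝ) / 2),
      ← Finset.sum_add_distrib, Finset.mul_sum (a := η), Finset.mul_sum (a := 1 / ((n : ℝ) + 1))]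
    have e3 : (n : ℝ) * ((1 - η) * k) = ∑ j : Fin n, (1 - η) * k := by simp
    rw [e3, ← Finset.sum_sub_distrib, ← Finset.sum_add_distrib]
    refine Finset.sum_congr rfl fun j _ => ?_
    rw [Finset.mul_sum (a := (1 : ℝ) / 2), ← Finset.sum_add_distrib, ← Finset.sum_sub_distrib]
    congr 2
    refine Finset.sum_congr rfl fun i _ => ?_
    ring
  simp only [Fin.val_castSucc] at hcols
  rw [hL] at hcols
  have hMI := array_mutual_information_le q v
  simp only [hcol, Finset.sum_const, Finset.card_univ, Fintype.card_fin, nsmul_eq_mul] at hMI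
  have hdists : ∑ j : Fin n, ∑ i, Law.dist ((q i j.castSucc).law v) ((q i j.castSucc).law v) ≤
      n * (2 * ((n : ℝ) + 1) * k) := by
    refine (Finset.sum_le_sum fun j _ => hdist j.castSucc).trans ?_
    simp
  rw [hW, hWpow]
  have hdl := hdist (Fin.last n)
  generalize ∑ i, Law.H (∏ j, (q i j).law v) = r at *
  generalize ∑ i, Law.H (μ i) = s at *
  generalize Law.H ((∏ i, μ i) ^ (n + 1)) = w at *
  generalize ∑ j : Fin n, ∑ i, Law.dist ((q i j.castSucc).law v) ((q i j.castSucc).law v) = d1 at *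
  generalize ∑ i, Law.dist ((q i (Fin.last n)).law v) ((q i (Fin.last n)).law v) = d2 at *
  generalize ∑ i, Law.dist ((q i (Fin.last n)).law v) (∏ j, (q i j).law v) = d3 at *
  have a1 := mul_le_mul_of_nonneg_left hlast2 hη
  have a2 := mul_le_mul_of_nonneg_left (add_le_add (add_le_add hdists hdl) hrowH) hη
  have a3 : 1 / ((n : ℝ) + 1) * (n * s - (r - s)) = s - 1 / ((n : ℝ) + 1) * r := by
    field_simp
    ring
  rw [a3] at hcols
  push_cast at hMI
  -- The row entropies cancel, leaving ηk times m for the m losses, 2m² for the self-distances and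
  -- m(2m - 1) for the growth of the row sums: 4m² in all, with m = n + 1.
  refine le_trans (sub_le_sub_right (hMI.trans (sub_le_sub_left hcols _)) w) ?_
  linarith

end Array

/-! ### The entropic Balog-Szemerédi-Gowers inequality. -/

namespace FinProb

variable {Ω Ω' : Type*} [Fintype Ω] [Fintype Ω'] {α β γ : Type*} (p : FinProb Ω)

lemma ent_congr_ae (X Y : Ω → α) (h : ∀ ω, 0 < p.w ω → X ω = Y ω) : p.ent X = p.ent Y := by
  classical
  have hpr : ∀ a, p.pr X a = p.pr Y a := fun a => by
    refine Finset.sum_congr rfl fun ω _ => ?_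
    rcases (p.nonneg ω).eq_or_lt with h0 | h0
    · simp [← h0]
    · rw [h ω h0]
  refine Finset.sum_congr rfl fun ω _ => ?_
  rcases (p.nonneg ω).eq_or_lt with h0 | h0
  · simp [← h0]
  · rw [h ω h0, hpr]

/-- The law of a pair given the law of the first member and the conditional laws of the second. -/
def bind (κ : Ω → FinProb Ω') : FinProb (Ω × Ω') where
  w ω := p.w ω.1 * (κ ω.1).w ω.2
  nonneg ω := mul_nonneg (p.nonneg _) ((κ _).nonneg _)
  sum_eq_one := by
    rw [Fintype.sum_prod_type]
    simp [← Finset.mul_sum, p.sum_eq_one, (κ _).sum_eq_one]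

lemma expect_bind (κ : Ω → FinProb Ω') (f : Ω × Ω' → ℝ) :
    (p.bind κ).expect f = p.expect fun ω => (κ ω).expect fun ω' => f (ω, ω') := by
  simp only [expect, Fintype.sum_prod_type, Finset.mul_sum, bind, mul_assoc]

lemma expect_ite [DecidableEq α] (X : Ω → α) (a : α) :
    p.expect (fun ω => if X ω = a then 1 else 0) = p.pr X a := by
  simp only [expect, pr, mul_ite, mul_one, mul_zero]
  exact Finset.sum_congr rfl fun ω _ => by congr

lemma isPush_bind_fst (κ : Ω → FinProb Ω') : (p.bind κ).IsPush p Prod.fst := by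
  classical
  intro ω
  rw [← expect_ite, expect_bind]
  have h : p.expect (fun ω' => (κ ω').expect fun _ => if ω' = ω then (1 : ℝ) else 0) = p.w ω := by
    simp only [expect_const]
    simp [expect]
  exact h

lemma ent_bind (κ : Ω → FinProb Ω') (X : Ω' → α) :
    (p.bind κ).ent (fun ω => (ω.1, X ω.2)) = p.ent (fun ω => ω) + p.expect fun ω => (κ ω).ent X := by
  classical
  have hpr : ∀ ω a, (p.bind κ).pr (fun ω => (ω.1, X ω.2)) (ω, a) = p.w ω * (κ ω).pr X a := by
    intro ω a
    rw [pr, Fintype.sum_prod_type, Finset.sum_eq_single ω]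
    · rw [pr, Finset.mul_sum]
      refine Finset.sum_congr rfl fun ω' _ => ?_
      by_cases h : X ω' = a <;> simp [h, bind]
    · intro ω' _ h
      simp [h]
    · simp
  have hid : ∀ ω, p.pr (fun ω => ω) ω = p.w ω := fun ω => by simp [pr]
  change (p.bind κ).expect (fun ω => -Real.log ((p.bind κ).pr (fun ω => (ω.1, X ω.2)) (ω.1, X ω.2))) =
    p.expect (fun ω => -Real.log (p.pr (fun ω => ω) ω)) + _
  rw [expect_bind, ← expect_add]
  refine expect_congr _ fun ω hω => ?_
  change _ = _ + (κ ω).expect fun ω' => -Real.log ((κ ω).pr X (X ω'))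
  rw [← (κ ω).expect_const (-Real.log (p.pr (fun ω => ω) ω)), ← expect_add]
  refine expect_congr _ fun ω' hω' => ?_
  rw [hpr, hid, Real.log_mul hω.ne' ((κ ω).pr_pos X hω').ne']
  ring

/-- A copy sampled from the conditionings on the values of `V` has the original law. -/
lemma isPush_bind_cond (V : Ω → β) (κ : Ω → FinProb Ω') (f : Ω' → Ω)
    (h : ∀ ω, (κ ω).IsPush (p.cond V (V ω)) f) : (p.bind κ).IsPush p (fun ω => f ω.2) := by
  classical
  intro ω
  rw [← expect_ite, expect_bind]
  have : ∀ ω', ((κ ω').expect fun x => if f x = ω then (1 : ℝ) else 0) =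
      (p.cond V (V ω')).expect fun x => if x = ω then (1 : ℝ) else 0 := fun ω' =>
    (h ω').expect fun x => if x = ω then (1 : ℝ) else 0
  simp only [this, sum_cond]
  simp [expect]

variable {G : Type*} [AddCommGroup G]

/-- The entropic Balog-Szemerédi-Gowers inequality for three variables of sum zero, relative to a
further variable `W`: the conditioning `U` of `Z₂` on the values of `(Z₃, W)` has small doubling on
average. -/
lemma expect_doubling_cond_le (Z₁ Z₂ Z₃ : Ω → G) (W : Ω → β) (hZ : ∀ ω, Z₁ ω + Z₂ ω + Z₃ ω = 0) :
    p.expect (fun ω => Law.H ((p.cond (fun ω => (Z₃ ω, W ω)) (Z₃ ω, W ω)).law Z₂ *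
        (p.cond (fun ω => (Z₃ ω, W ω)) (Z₃ ω, W ω)).law Z₂)) -
      p.expect (fun ω => Law.H ((p.cond (fun ω => (Z₃ ω, W ω)) (Z₃ ω, W ω)).law Z₂)) ≤
    2 * (p.ent (fun ω => (Z₁ ω, W ω)) + p.ent (fun ω => (Z₂ ω, W ω)) +
      p.ent (fun ω => (Z₃ ω, W ω))) - 3 * p.ent (fun ω => (Z₂ ω, Z₃ ω, W ω)) - 3 * p.ent W := by
  let V : Ω → G × β := fun ω => (Z₃ ω, W ω)
  let κ : Ω → FinProb Ω := fun ω => p.cond V (V ω)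
  -- The whole base point is kept as first coordinate. Given it, the other two are independent
  -- samples conditioned on its value of `V`, so averages of entropies become entropies on `P`.
  let P := p.bind fun ω => (κ ω).prod (κ ω)
  let a : Ω × Ω × Ω → G := fun ω => Z₂ ω.2.1
  let b : Ω × Ω × Ω → G := fun ω => Z₂ ω.2.2
  let z : Ω × Ω × Ω → G := fun ω => Z₃ ω.1
  let w : Ω × Ω × Ω → β := fun ω => W ω.1
  -- Jointly with `w`, both -a - z and -b - z are copies of `Z₁`, and `R` is (-a - z) - b as well as
  -- (-b - z) - a. Given `z`, it carries the information of a + b.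
  let R : Ω × Ω × Ω → G := fun ω => -z ω - a ω - b ω
  have hsupp : ∀ ω, 0 < P.w ω → V ω.2.1 = V ω.1 ∧ V ω.2.2 = V ω.1 := by
    rintro ⟨ω₀, ω₁, ω₂⟩ h
    have h0 : 0 < p.w ω₀ := by
      refine (p.nonneg _).lt_of_ne' fun h' => ?_
      simp [P, bind, h'] at h
    have hv := (p.pr_pos V h0).ne'
    have h1 : 0 < (κ ω₀).w ω₁ := by
      refine ((κ ω₀).nonneg _).lt_of_ne' fun h' => ?_
      simp [P, bind, prod, h'] at h
    have h2 : 0 < (κ ω₀).w ω₂ := by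
      refine ((κ ω₀).nonneg _).lt_of_ne' fun h' => ?_
      simp [P, bind, prod, h'] at h
    exact ⟨(p.pos_of_cond_pos V hv h1).2, (p.pos_of_cond_pos V hv h2).2⟩
  have push0 : P.IsPush p Prod.fst := p.isPush_bind_fst _
  have push1 : P.IsPush p (fun ω => ω.2.1) :=
    p.isPush_bind_cond V _ Prod.fst fun ω => isPush_fst _ _
  have push2 : P.IsPush p (fun ω => ω.2.2) :=
    p.isPush_bind_cond V _ Prod.snd fun ω => isPush_snd _ _
  have hZ1 : ∀ ω, Z₁ ω = -Z₂ ω - Z₃ ω := fun ω => by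
    rw [← sub_eq_zero, ← hZ ω]; abel
  -- the entropies of the marginals
  have eZ1 : P.ent (fun ω => (-a ω - z ω, w ω)) = p.ent (fun ω => (Z₁ ω, W ω)) := by
    rw [← push1.ent (fun ω => (Z₁ ω, W ω))]
    refine P.ent_congr_ae _ _ fun ω h => ?_
    have := (hsupp ω h).1
    simp only [V, Prod.mk.injEq] at this
    rw [hZ1, this.1, this.2]
  have eZ1' : P.ent (fun ω => (-b ω - z ω, w ω)) = p.ent (fun ω => (Z₁ ω, W ω)) := by
    rw [← push2.ent (fun ω => (Z₁ ω, W ω))]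
    refine P.ent_congr_ae _ _ fun ω h => ?_
    have := (hsupp ω h).2
    simp only [V, Prod.mk.injEq] at this
    rw [hZ1, this.1, this.2]
  have ea : P.ent (fun ω => (a ω, w ω)) = p.ent (fun ω => (Z₂ ω, W ω)) := by
    rw [← push1.ent (fun ω => (Z₂ ω, W ω))]
    refine P.ent_congr_ae _ _ fun ω h => ?_
    have := (hsupp ω h).1
    simp only [V, Prod.mk.injEq] at this
    rw [this.2]
  have eb : P.ent (fun ω => (b ω, w ω)) = p.ent (fun ω => (Z₂ ω, W ω)) := by
    rw [← push2.ent (fun ω => (Z₂ ω, W ω))]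
    refine P.ent_congr_ae _ _ fun ω h => ?_
    have := (hsupp ω h).2
    simp only [V, Prod.mk.injEq] at this
    rw [this.2]
  have ew : P.ent w = p.ent W := push0.ent W
  have eV : P.ent (fun ω => (z ω, w ω)) = p.ent V := push0.ent V
  have eid : P.ent (fun ω => ω.1) = p.ent (fun ω => ω) := push0.ent fun ω => ω
  -- the entropies of the conditionally independent copies
  have hchain := p.expect_ent_cond V Z₂
  have hab : P.ent (fun ω => (ω.1, a ω, b ω)) = p.ent (fun ω => ω) +
      2 * (p.ent (fun ω => (Z₂ ω, V ω)) - p.ent V) := by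
    rw [← hchain, ← expect_const_mul]
    refine (p.ent_bind (fun ω => (κ ω).prod (κ ω))
      (fun ω : Ω × Ω => (Z₂ ω.1, Z₂ ω.2))).trans ?_
    simp only [ent_prod, κ, two_mul]
  have hsum : P.ent (fun ω => (ω.1, a ω + b ω)) = p.ent (fun ω => ω) +
      p.expect (fun ω => Law.H ((κ ω).law Z₂ * (κ ω).law Z₂)) := by
    refine (p.ent_bind (fun ω => (κ ω).prod (κ ω))
      (fun ω : Ω × Ω => Z₂ ω.1 + Z₂ ω.2)).trans ?_
    simp only [← law_add_prod, Law.H_law]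
  have k1 := P.ent_submodular (fun ω => (a ω, b ω, z ω, w ω)) (fun ω => ω.1)
    (fun ω => (ω.1, a ω, b ω)) (fun ω => (z ω, w ω))
    (fun ω ω' h => by simp_all) (fun ω ω' h => by simp only [z, w, h])
    (fun ω ω' h h' => by simp_all)
  have k2 := P.ent_submodular (fun ω => (R ω, z ω, w ω)) (fun ω => ω.1)
    (fun ω => (ω.1, a ω + b ω)) (fun ω => (z ω, w ω))
    (fun ω ω' h => by simp_all) (fun ω ω' h => by simp only [z, w, h])
    (fun ω ω' h h' => by
      simp only [Prod.mk.injEq] at h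
      have e : ∀ ω, a ω + b ω = -z ω - R ω := fun ω => by simp only [R]; abel
      rw [e, e, h.1, h.2.1, h'])
  have k3 := P.ent_submodular (fun ω => (R ω, w ω)) (fun ω => (z ω, w ω))
    (fun ω => (R ω, z ω, w ω)) w (fun ω ω' h => by simp_all) (fun ω ω' h => by simp_all)
    (fun ω ω' h h' => by simp_all)
  -- The main step: `R` is common to the two triples, which together recover a, b and z. Conditional
  -- independence makes the entropy of (a, b, z, w) large, so that of `R` is small.
  have k4 := P.ent_submodular (fun ω => (-a ω - z ω, R ω, w ω)) (fun ω => (-b ω - z ω, R ω, w ω))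
    (fun ω => (a ω, b ω, z ω, w ω)) (fun ω => (R ω, w ω))
    (fun ω ω' h => by simp_all) (fun ω ω' h => by simp_all)
    (fun ω ω' h h' => by
      simp only [Prod.mk.injEq] at h h'
      have e1 : ∀ ω, a ω = (-b ω - z ω) - R ω := fun ω => by simp only [R]; abel
      have e2 : ∀ ω, b ω = (-a ω - z ω) - R ω := fun ω => by simp only [R]; abel
      have e3 : ∀ ω, z ω = R ω - (-a ω - z ω) - (-b ω - z ω) := fun ω => by simp only [R]; abel
      have q1 : a ω = a ω' := by rw [e1 ω, e1 ω', h'.1, h.2.1]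
      have q2 : b ω = b ω' := by rw [e2 ω, e2 ω', h.1, h.2.1]
      have q3 : z ω = z ω' := by rw [e3 ω, e3 ω', h.1, h'.1, h.2.1]
      rw [q1, q2, q3, h.2.2])
  have k5 := P.ent_submodular (fun ω => (-a ω - z ω, w ω)) (fun ω => (b ω, w ω))
    (fun ω => (-a ω - z ω, R ω, w ω)) w (fun ω ω' h => by simp_all) (fun ω ω' h => by simp_all)
    (fun ω ω' h h' => by
      simp only [Prod.mk.injEq] at h h'
      have e : ∀ ω, R ω = (-a ω - z ω) - b ω := fun ω => by simp only [R]; abel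
      rw [e, e ω', h.1, h'.1, h.2])
  have k6 := P.ent_submodular (fun ω => (-b ω - z ω, w ω)) (fun ω => (a ω, w ω))
    (fun ω => (-b ω - z ω, R ω, w ω)) w (fun ω ω' h => by simp_all) (fun ω ω' h => by simp_all)
    (fun ω ω' h h' => by
      simp only [Prod.mk.injEq] at h h'
      have e : ∀ ω, R ω = (-b ω - z ω) - a ω := fun ω => by simp only [R]; abel
      rw [e, e ω', h.1, h'.1, h.2])
  have hH : p.expect (fun ω => Law.H ((κ ω).law Z₂)) = p.ent (fun ω => (Z₂ ω, V ω)) - p.ent V := by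
    rw [← hchain]
    simp only [Law.H_law, κ]
  change p.expect (fun ω => Law.H ((κ ω).law Z₂ * (κ ω).law Z₂)) -
    p.expect (fun ω => Law.H ((κ ω).law Z₂)) ≤ 2 * (p.ent (fun ω => (Z₁ ω, W ω)) +
      p.ent (fun ω => (Z₂ ω, W ω)) + p.ent V) - 3 * p.ent (fun ω => (Z₂ ω, V ω)) - 3 * p.ent W
  linarith

end FinProb

/-! ### Rearranged arrays. -/

section Reindex

open FinProb

variable {G : Type*} [AddCommGroup G] {ι : Type*} [Fintype ι] [DecidableEq ι] {F : Type*} [Fintype F]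
  {n : ℕ}

/-- The rearrangement of the entries of an array. -/
def rearrange (e : ι × Fin (n + 1) ≃ ι × Fin (n + 1)) (ω : ι → Fin (n + 1) → F) :
    ι → Fin (n + 1) → F :=
  fun i j => ω (e (i, j)).1 (e (i, j)).2

omit [Fintype ι] [DecidableEq ι] [Fintype F] in
lemma rearrange_symm (e : ι × Fin (n + 1) ≃ ι × Fin (n + 1)) (ω : ι → Fin (n + 1) → F) :
    rearrange e (rearrange e.symm ω) = ω := by
  funext i j
  simp [rearrange]

lemma isPush_rearrange (q : ι → Fin (n + 1) → FinProb F)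
    (e : ι × Fin (n + 1) ≃ ι × Fin (n + 1)) :
    (arrayProb q).IsPush (arrayProb (rearrange e q)) (rearrange e) := by
  classical
  intro ω'
  rw [pr, Finset.sum_eq_single (rearrange e.symm ω'), if_pos (rearrange_symm e ω')]
  · simp only [arrayProb, pi]
    rw [← Fintype.prod_prod_type' (f := fun i j => (q i j).w (rearrange e.symm ω' i j)),
      ← Fintype.prod_prod_type' (f := fun i j => (rearrange e q i j).w (ω' i j)),
      ← Equiv.prod_comp e]
    refine Finset.prod_congr rfl fun a _ => ?_
    simp [rearrange]
  · intro ω _ hω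
    rw [if_neg]
    rintro rfl
    exact hω (rearrange_symm e.symm ω).symm
  · simp

omit [DecidableEq ι] [Fintype F] in
lemma sum_rearrange (v : F → G) (e : ι × Fin (n + 1) ≃ ι × Fin (n + 1))
    (ω : ι → Fin (n + 1) → F) :
    ∑ i, ∑ j, v (rearrange e ω i j) = ∑ i, ∑ j, v (ω i j) := by
  rw [← Fintype.sum_prod_type' (f := fun i j => v (rearrange e ω i j)),
    ← Fintype.sum_prod_type' (f := fun i j => v (ω i j))]
  exact Equiv.sum_comp e fun a : ι × Fin (n + 1) => v (ω a.1 a.2)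

/-- The conditional mutual information of functions of the row sums and of the column sums of a
rearranged array. -/
lemma rearrange_mutual_information_le [Nonempty ι] (q : ι → FinProb F) (v : F → G) (μ : ι → Law G)
    (hq : ∀ i, (q i).law v = μ i) {T : Set G} {η : ℝ}
    (hη : 0 ≤ η) (hcard : Fintype.card ι = n + 1) (τ : Equiv.Perm ι) (hτ : ∀ i, τ i ≠ i)
    (hmin : Law.NearMin T η (Law.multidist μ) μ) (hv : ∀ f, v f ∈ T)
    (hsum : ∀ b : Fin (n + 1) → F, ∑ j, v (b j) ∈ T)
    (e : ι × Fin (n + 1) ≃ ι × Fin (n + 1)) (σ : Fin (n + 1) → Equiv.Perm ι)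
    (he : ∀ i j, (e (i, j)).1 = σ j i) (f g : (ι → Fin (n + 1) → F) → G)
    (hf : ∀ ω ω', (∀ j, ∑ i, v (rearrange e ω i j) = ∑ i, v (rearrange e ω' i j)) → f ω = f ω')
    (hg : ∀ ω ω', (∀ i, ∑ j, v (rearrange e ω i j) = ∑ j, v (rearrange e ω' i j)) → g ω = g ω') :
    let p := arrayProb (n := n) fun i _ => q i
    p.ent (fun ω => (f ω, ∑ i, ∑ j, v (ω i j))) + p.ent (fun ω => (g ω, ∑ i, ∑ j, v (ω i j))) -
      p.ent (fun ω => (f ω, g ω, ∑ i, ∑ j, v (ω i j))) - p.ent (fun ω => ∑ i, ∑ j, v (ω i j)) ≤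
      4 * ((n : ℝ) + 1) ^ 2 * η * Law.multidist μ := by
  intro p
  let C : (ι → Fin (n + 1) → F) → Fin (n + 1) → G := fun ω j => ∑ i, v (rearrange e ω i j)
  let R : (ι → Fin (n + 1) → F) → ι → G := fun ω i => ∑ j, v (rearrange e ω i j)
  let W : (ι → Fin (n + 1) → F) → G := fun ω => ∑ i, ∑ j, v (ω i j)
  have hWC : ∀ ω ω', C ω = C ω' → W ω = W ω' := fun ω ω' h => by
    simp only [W]
    rw [← sum_rearrange v e ω, ← sum_rearrange v e ω', Finset.sum_comm,
      Finset.sum_comm (f := fun i j => v (rearrange e ω' i j))]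
    exact Finset.sum_congr rfl fun j _ => congrFun h j
  have hWR : ∀ ω ω', R ω = R ω' → W ω = W ω' := fun ω ω' h => by
    simp only [W]
    rw [← sum_rearrange v e ω, ← sum_rearrange v e ω']
    exact Finset.sum_congr rfl fun j _ => congrFun h j
  have push := isPush_rearrange (fun i (_ : Fin (n + 1)) => q i) e
  have h := array_mutual_information_le_of_nearMin (rearrange e fun i (_ : Fin (n + 1)) => q i) v μ
    hη hcard τ hτ hmin hv hsum σ (fun i j => by rw [← he i j]; exact hq _)
  rw [← push.ent (fun ω j => ∑ i, v (ω i j)), ← push.ent (fun ω i => ∑ j, v (ω i j)),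
    ← push.ent (fun ω => ((fun j => ∑ i, v (ω i j)), fun i => ∑ j, v (ω i j))),
    ← push.ent (fun ω => ∑ i, ∑ j, v (ω i j))] at h
  simp only [sum_rearrange] at h
  -- Data processing given `W`, which is a function of `C` and of `R`: first `C` is replaced by `f`,
  -- then `R` by `g`.
  have k1 := p.ent_submodular C (fun ω => (f ω, R ω)) (fun ω => (C ω, R ω)) (fun ω => (f ω, W ω))
    (fun ω ω' h => by rw [hf ω ω' fun j => congrFun h j, hWC ω ω' h])
    (fun ω ω' h => by
      rw [Prod.mk.injEq] at h
      rw [h.1, hWR ω ω' h.2])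
    (fun ω ω' h h' => by
      rw [Prod.mk.injEq] at h'
      rw [h, h'.2])
  have k2 := p.ent_submodular R (fun ω => (f ω, g ω, W ω)) (fun ω => (f ω, R ω))
    (fun ω => (g ω, W ω))
    (fun ω ω' h => by rw [hg ω ω' fun j => congrFun h j, hWR ω ω' h])
    (fun ω ω' h => by
      simp only [Prod.mk.injEq] at h
      rw [h.2.1, h.2.2])
    (fun ω ω' h h' => by
      rw [Prod.mk.injEq] at h'
      rw [h, h'.1])
  change p.ent C + p.ent R - p.ent (fun ω => (C ω, R ω)) - p.ent W ≤ _ at h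
  change p.ent (fun ω => (f ω, W ω)) + p.ent (fun ω => (g ω, W ω)) -
    p.ent (fun ω => (f ω, g ω, W ω)) - p.ent W ≤ _
  linarith

end Reindex

/-! ### Shears of the index square. -/

section Fin

variable {n : ℕ}

lemma dvd_val_add_val_add_val (i j : Fin (n + 1)) :
    (n + 1) ∣ (i : ℕ) + j + ((-i - j : Fin (n + 1)) : ℕ) := by
  have h : i + j + (-i - j) = 0 := by abel
  have := congrArg Fin.val h
  rw [Fin.val_add, Fin.val_add, Nat.mod_add_mod] at this
  exact Nat.dvd_of_mod_eq_zero this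

/-- The involution `j ↦ -i - j`. -/
def negSub (i : Fin (n + 1)) : Equiv.Perm (Fin (n + 1)) where
  toFun j := -i - j
  invFun j := -i - j
  left_inv j := sub_sub_cancel (-i) j
  right_inv j := sub_sub_cancel (-i) j

/-- The rearrangement `(i, j) ↦ (i, -i - j)` of the index set of a square array. -/
def shearRow : Fin (n + 1) × Fin (n + 1) ≃ Fin (n + 1) × Fin (n + 1) where
  toFun a := (a.1, negSub a.1 a.2)
  invFun a := (a.1, negSub a.1 a.2)
  left_inv a := Prod.ext rfl ((negSub a.1).left_inv a.2)
  right_inv a := Prod.ext rfl ((negSub a.1).left_inv a.2)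

/-- The rearrangement `(i, j) ↦ (-i - j, j)` of the index set of a square array. -/
def shearCol : Fin (n + 1) × Fin (n + 1) ≃ Fin (n + 1) × Fin (n + 1) where
  toFun a := (negSub a.2 a.1, a.2)
  invFun a := (negSub a.2 a.1, a.2)
  left_inv a := Prod.ext ((negSub a.2).left_inv a.1) rfl
  right_inv a := Prod.ext ((negSub a.2).left_inv a.1) rfl

end Fin

/-! ### No near-minimizer has positive multidistance. -/

section Decrement

open FinProb

variable {G : Type*} [AddCommGroup G] {F : Type*} [Fintype F] {n : ℕ}

/-- The sum of the entries of a square array, weighted by `c`. -/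
def weightedSum (v : F → G) (c : Fin (n + 1) → Fin (n + 1) → ℕ)
    (ω : Fin (n + 1) → Fin (n + 1) → F) : G :=
  ∑ i, ∑ j, c i j • v (ω i j)

omit [Fintype F] in
lemma weightedSum_row (v : F → G) (c : Fin (n + 1) → ℕ) (ω : Fin (n + 1) → Fin (n + 1) → F) :
    weightedSum v (fun i _ => c i) ω = ∑ i, c i • ∑ j, v (ω i j) := by
  simp [weightedSum, Finset.smul_sum]

omit [Fintype F] in
lemma weightedSum_col (v : F → G) (c : Fin (n + 1) → ℕ) (ω : Fin (n + 1) → Fin (n + 1) → F) :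
    weightedSum v (fun _ j => c j) ω = ∑ j, c j • ∑ i, v (ω i j) := by
  rw [weightedSum, Finset.sum_comm]
  simp [Finset.smul_sum]

omit [Fintype F] in
lemma weightedSum_rearrange (v : F → G) (c : Fin (n + 1) → Fin (n + 1) → ℕ)
    (e : Fin (n + 1) × Fin (n + 1) ≃ Fin (n + 1) × Fin (n + 1))
    (ω : Fin (n + 1) → Fin (n + 1) → F) :
    weightedSum v (fun i j => c (e (i, j)).1 (e (i, j)).2) (rearrange e ω) = weightedSum v c ω := by
  simp only [weightedSum]
  rw [← Fintype.sum_prod_type' (f := fun i j => c (e (i, j)).1 (e (i, j)).2 • v (rearrange e ω i j)),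
    ← Fintype.sum_prod_type' (f := fun i j => c i j • v (ω i j))]
  exact Equiv.sum_comp e fun a : Fin (n + 1) × Fin (n + 1) => c a.1 a.2 • v (ω a.1 a.2)

lemma negSub_negSub_left (i j : Fin (n + 1)) : -i - (-i - j) = j := sub_sub_cancel (-i) j

lemma finRotate_ne (hn : 1 ≤ n) (i : Fin (n + 1)) : finRotate (n + 1) i ≠ i := by
  obtain ⟨k, rfl⟩ := Nat.exists_eq_succ_of_ne_zero (Nat.one_le_iff_ne_zero.1 hn)
  rw [finRotate_apply]
  simp

lemma law_weightedSum_col (q : Fin (n + 1) → FinProb F) (v : F → G) :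
    (arrayProb fun i (_ : Fin (n + 1)) => q i).law (weightedSum v fun _ j => j) =
      ∏ j : Fin (n + 1), Law.dil j (∏ i, (q i).law v) := by
  have h := law_sum_pi (fun i => pi fun _ : Fin (n + 1) => q i)
    (fun _ b => ∑ j : Fin (n + 1), (j : ℕ) • v (b j))
  refine h.trans ?_
  simp only [map_prod]
  rw [Finset.prod_comm]
  refine Finset.prod_congr rfl fun i _ => ?_
  refine (law_sum_pi (fun _ => q i) (fun (j : Fin (n + 1)) f => (j : ℕ) • v f)).trans ?_
  simp only [Law.dil_law]

/-- The total sum of the array is nearly independent of the weighted sum of its columns. -/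
lemma ent_weightedSum_col_pair_ge (q : Fin (n + 1) → FinProb F) (v : F → G) :
    let p := arrayProb fun i (_ : Fin (n + 1)) => q i
    p.ent (weightedSum v fun _ j => j) + Law.H (∏ i, (q i).law v) ≤
      p.ent (fun ω => (weightedSum v (fun _ j => j) ω, ∑ i, ∑ j, v (ω i j))) := by
  intro p
  -- Column 0 has weight 0, so its sum, a copy of the full sum of the tuple, is independent of the
  -- weighted sum and still contributes to the total.
  let x : (Fin (n + 1) → Fin (n + 1) → F) → {a : Fin (n + 1) × Fin (n + 1) // a.2 ≠ 0} → F :=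
    fun ω a => ω a.1.1 a.1.2
  let C : (Fin (n + 1) → Fin (n + 1) → F) → G := fun ω => ∑ i, v (ω i 0)
  let Z : (Fin (n + 1) → Fin (n + 1) → F) → G := weightedSum v fun _ j => j
  let W : (Fin (n + 1) → Fin (n + 1) → F) → G := fun ω => ∑ i, ∑ j, v (ω i j)
  have hx : ∀ ω ω', x ω = x ω' → ∀ i (j : Fin (n + 1)), j ≠ 0 → ω i j = ω' i j :=
    fun ω ω' h i j hj => congrFun h ⟨(i, j), hj⟩
  have hW : ∀ ω, W ω = C ω + ∑ i, ∑ j ∈ Finset.univ.erase 0, v (ω i j) := fun ω => by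
    simp only [W, C]
    rw [← Finset.sum_add_distrib]
    exact Finset.sum_congr rfl fun i _ =>
      (Finset.add_sum_erase _ (fun j => v (ω i j)) (Finset.mem_univ _)).symm
  have hrest : ∀ ω ω', x ω = x ω' → ∑ i, ∑ j ∈ Finset.univ.erase 0, v (ω i j) =
      ∑ i, ∑ j ∈ Finset.univ.erase 0, v (ω' i j) := fun ω ω' h =>
    Finset.sum_congr rfl fun i _ => Finset.sum_congr rfl fun j hj => by
      rw [hx ω ω' h i j (Finset.ne_of_mem_erase hj)]
  have hZ : ∀ ω ω', x ω = x ω' → Z ω = Z ω' := fun ω ω' h => by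
    refine Finset.sum_congr rfl fun i _ => Finset.sum_congr rfl fun j _ => ?_
    by_cases hj : j = 0
    · simp [hj]
    · rw [hx ω ω' h i j hj]
  have h1 : p.ent x + p.ent C ≤ p.ent (fun ω => (x ω, C ω)) := by
    refine p.ent_add_le_of_compl (fun (a : Fin (n + 1) × Fin (n + 1)) ω => ω a.1 a.2)
      (array_total _) (fun a => a.2 ≠ 0) x C ?_ ?_
    · intro ω ω' h
      funext a
      exact h a.1 a.2
    · intro ω ω' h
      exact Finset.sum_congr rfl fun i _ => by rw [h (i, 0) (by simp)]
  have h2 := p.ent_submodular (fun ω => (Z ω, W ω)) x (fun ω => (x ω, C ω)) Z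
    (fun ω ω' h => congrArg Prod.fst h) hZ
    (fun ω ω' h h' => by
      rw [Prod.mk.injEq] at h
      have := h.2
      rw [hW, hW, hrest ω ω' h', add_left_inj] at this
      rw [h', this])
  have h3 : p.ent C = Law.H (∏ i, (q i).law v) := by
    rw [← Law.H_law]
    congr 1
    refine (law_sum_pi (fun i => pi fun _ : Fin (n + 1) => q i) (fun _ b => v (b 0))).trans ?_
    exact Finset.prod_congr rfl fun i _ => row_law_eval _ v 0
  change p.ent Z + _ ≤ p.ent (fun ω => (Z ω, W ω))
  linarith

/-- A tuple of laws on a group of exponent dividing its length does not nearly minimize the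
multidistance, unless its multidistance is zero. -/
theorem not_nearMin (hn : 1 ≤ n) (hG : ∀ g : G, (n + 1) • g = 0) (μ : Fin (n + 1) → Law G)
    (q : Fin (n + 1) → FinProb F) (v : F → G) (hq : ∀ i, (q i).law v = μ i) {T : Set G}
    {c η : ℝ} (hc0 : 0 < c) (hc : c ≤ 1 / 100) (hη : η = c / ((n : ℝ) + 1) ^ 3)
    (hk : 0 < Law.multidist μ) (hv : ∀ f, v f ∈ T)
    (hsum : ∀ b : Fin (n + 1) → F, ∑ j, v (b j) ∈ T)
    (hwsum : ∀ ω : Fin (n + 1) → Fin (n + 1) → F, weightedSum v (fun _ j => j) ω ∈ T) :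
    ¬ Law.NearMin T η (Law.multidist μ) μ := by
  intro hmin
  have hη0 : 0 ≤ η := by rw [hη]; positivity
  set k := Law.multidist μ with hkdef
  let p := arrayProb fun i (_ : Fin (n + 1)) => q i
  let W : (Fin (n + 1) → Fin (n + 1) → F) → G := fun ω => ∑ i, ∑ j, v (ω i j)
  let Z₁ : (Fin (n + 1) → Fin (n + 1) → F) → G := weightedSum v fun i _ => i
  let Z₂ : (Fin (n + 1) → Fin (n + 1) → F) → G := weightedSum v fun _ j => j
  let Z₃ : (Fin (n + 1) → Fin (n + 1) → F) → G :=
    weightedSum v fun i j => ((-i - j : Fin (n + 1)) : ℕ)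
  let t := 4 * ((n : ℝ) + 1) ^ 2 * η * k
  have hτ := finRotate_ne hn
  have hcard : Fintype.card (Fin (n + 1)) = n + 1 := Fintype.card_fin _
  have hZ : ∀ ω, Z₁ ω + Z₂ ω + Z₃ ω = 0 := by
    intro ω
    simp only [Z₁, Z₂, Z₃, weightedSum, ← Finset.sum_add_distrib, ← add_smul]
    refine Finset.sum_eq_zero fun i _ => Finset.sum_eq_zero fun j _ => ?_
    obtain ⟨d, hd⟩ := dvd_val_add_val_add_val i j
    rw [hd, mul_comm, mul_smul, hG, smul_zero]
  -- the three conditional mutual informations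
  have I12 : p.ent (fun ω => (Z₂ ω, W ω)) + p.ent (fun ω => (Z₁ ω, W ω)) -
      p.ent (fun ω => (Z₂ ω, Z₁ ω, W ω)) - p.ent W ≤ t := by
    refine rearrange_mutual_information_le q v μ hq hη0 hcard (finRotate _) hτ hmin hv hsum
      (Equiv.refl _) (fun _ => Equiv.refl _) (fun i j => rfl) Z₂ Z₁ ?_ ?_
    · intro ω ω' h
      simp only [Z₂, weightedSum_col]
      exact Finset.sum_congr rfl fun j _ => congrArg _ (h j)
    · intro ω ω' h
      simp only [Z₁, weightedSum_row]
      exact Finset.sum_congr rfl fun j _ => congrArg _ (h j)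
  have I13 : p.ent (fun ω => (Z₃ ω, W ω)) + p.ent (fun ω => (Z₁ ω, W ω)) -
      p.ent (fun ω => (Z₃ ω, Z₁ ω, W ω)) - p.ent W ≤ t := by
    -- After this shear the columns are indexed by -i - j, and each still meets every row once in
    -- the original order.
    refine rearrange_mutual_information_le q v μ hq hη0 hcard (finRotate _) hτ hmin hv hsum
      shearRow (fun _ => Equiv.refl _) (fun i j => rfl) Z₃ Z₁ ?_ ?_
    · have e : ∀ ω, Z₃ ω = weightedSum v (fun _ j => (j : ℕ)) (rearrange shearRow ω) := by
        intro ω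
        simp only [Z₃]
        rw [← weightedSum_rearrange v _ shearRow]
        simp only [shearRow, negSub, Equiv.coe_fn_mk, negSub_negSub_left]
      intro ω ω' h
      rw [e, e, weightedSum_col, weightedSum_col]
      exact Finset.sum_congr rfl fun j _ => congrArg _ (h j)
    · have e : ∀ ω, Z₁ ω = weightedSum v (fun i _ => (i : ℕ)) (rearrange shearRow ω) := by
        intro ω
        simp only [Z₁]
        rw [← weightedSum_rearrange v _ shearRow]
        rfl
      intro ω ω' h
      rw [e, e, weightedSum_row, weightedSum_row]
      exact Finset.sum_congr rfl fun j _ => congrArg _ (h j)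
  have I23 : p.ent (fun ω => (Z₂ ω, W ω)) + p.ent (fun ω => (Z₃ ω, W ω)) -
      p.ent (fun ω => (Z₂ ω, Z₃ ω, W ω)) - p.ent W ≤ t := by
    -- Now the rows are indexed by -i - j, so column `j` is genuinely permuted, by `negSub j`.
    refine rearrange_mutual_information_le q v μ hq hη0 hcard (finRotate _) hτ hmin hv hsum
      shearCol (fun j => negSub j) (fun i j => rfl) Z₂ Z₃ ?_ ?_
    · have e : ∀ ω, Z₂ ω = weightedSum v (fun _ j => (j : ℕ)) (rearrange shearCol ω) := by
        intro ω
        simp only [Z₂]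
        rw [← weightedSum_rearrange v _ shearCol]
        rfl
      intro ω ω' h
      rw [e, e, weightedSum_col, weightedSum_col]
      exact Finset.sum_congr rfl fun j _ => congrArg _ (h j)
    · have e : ∀ ω, Z₃ ω = weightedSum v (fun i _ => (i : ℕ)) (rearrange shearCol ω) := by
        intro ω
        simp only [Z₃]
        rw [← weightedSum_rearrange v _ shearCol]
        have : ∀ i j : Fin (n + 1), -(-j - i) - j = i := fun i j => by abel
        simp only [shearCol, negSub, Equiv.coe_fn_mk, this]
      intro ω ω' h
      rw [e, e, weightedSum_row, weightedSum_row]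
      exact Finset.sum_congr rfl fun j _ => congrArg _ (h j)
  -- Any two of the Z's determine the third, so the three joint entropies coincide and the bound in
  -- `hBSG` is the sum of the three informations.
  have e12 : p.ent (fun ω => (Z₂ ω, Z₁ ω, W ω)) = p.ent (fun ω => (Z₂ ω, Z₃ ω, W ω)) := by
    refine p.ent_congr _ _ fun ω ω' => ?_
    have h1 := (hZ ω).trans (hZ ω').symm
    simp only [Prod.mk.injEq]
    constructor
    · rintro ⟨a, b, c⟩
      rw [a, b, add_right_inj] at h1
      exact ⟨a, h1, c⟩
    · rintro ⟨a, b, c⟩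
      rw [a, b, add_left_inj, add_left_inj] at h1
      exact ⟨a, h1, c⟩
  have e13 : p.ent (fun ω => (Z₃ ω, Z₁ ω, W ω)) = p.ent (fun ω => (Z₂ ω, Z₃ ω, W ω)) := by
    refine p.ent_congr _ _ fun ω ω' => ?_
    have h1 := (hZ ω).trans (hZ ω').symm
    simp only [Prod.mk.injEq]
    constructor
    · rintro ⟨a, b, c⟩
      rw [a, b, add_left_inj, add_right_inj] at h1
      exact ⟨h1, a, c⟩
    · rintro ⟨a, b, c⟩
      rw [a, b, add_left_inj, add_left_inj] at h1
      exact ⟨b, h1, c⟩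
  rw [e12] at I12
  rw [e13] at I13
  have hBSG := p.expect_doubling_cond_le Z₁ Z₂ Z₃ W hZ
  let V : (Fin (n + 1) → Fin (n + 1) → F) → G × G := fun ω => (Z₃ ω, W ω)
  let U : (Fin (n + 1) → Fin (n + 1) → F) → Law G := fun ω => (p.cond V (V ω)).law Z₂
  change p.expect (fun ω => Law.H (U ω * U ω)) - p.expect (fun ω => Law.H (U ω)) ≤ _ at hBSG
  -- the distance to the original laws
  have hlaw : p.law Z₂ = ∏ j : Fin (n + 1), Law.dil j (∏ i, μ i) := by
    simp only [← hq]
    exact law_weightedSum_col q v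
  have hdist : ∀ i, p.expect (fun ω => Law.dist (μ i) (U ω)) ≤
      Law.H (μ i * Law.neg (p.law Z₂)) - 1 / 2 * Law.H (μ i) -
        1 / 2 * (p.ent (fun ω => (Z₂ ω, Z₃ ω, W ω)) - p.ent (fun ω => (Z₃ ω, W ω))) :=
    fun i => Law.expect_dist_cond_le p V Z₂ (μ i)
  have hdists := Finset.sum_le_sum fun i (_ : i ∈ Finset.univ) => hdist i
  rw [hlaw, Finset.sum_sub_distrib, Finset.sum_sub_distrib, ← Finset.mul_sum] at hdists
  have hneg := Law.sum_H_mul_neg_prod_dil_le μ (finRotate _) hτ (n + 1)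
  have hZW := ent_weightedSum_col_pair_ge q v
  change p.ent Z₂ + _ ≤ p.ent (fun ω => (Z₂ ω, W ω)) at hZW
  have hZ2 : Law.H (∏ i, μ i) ≤ p.ent Z₂ := by
    rw [← Law.H_law, hlaw]
    exact Law.H_le_prod_dil _ (by omega)
  have hWle : p.ent W ≤ Law.H (∏ i, μ i) + 2 * n * k := by
    have : p.law W = (∏ i, μ i) ^ (n + 1) := by
      refine (law_sum_pi (fun i => pi fun _ : Fin (n + 1) => q i)
        (fun _ b => ∑ j, v (b j))).trans ?_
      rw [← Finset.prod_pow]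
      refine Finset.prod_congr rfl fun i _ => ?_
      rw [law_sum_pi (fun _ => q i) (fun _ f => v f)]
      simp [hq]
    rw [← Law.H_law, this]
    exact Law.H_pow_le μ (finRotate _) hτ n
  have hD := Law.card_mul_multidist μ
  simp only [hq] at hZW
  -- the final comparison
  have hfin := p.expect_mono (f := fun _ => (1 - η) * k)
    (g := fun ω => (n : ℝ) * (Law.H (U ω * U ω) - Law.H (U ω)) +
      η * ∑ i, Law.dist (μ i) (U ω))
    (fun ω _ => by
      -- The competitor is the constant tuple of copies of the conditioned `Z₂`.
      have h1 := hmin (fun _ => U ω) fun i => Law.supportedIn_law _ _ hwsum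
      have h2 := Law.multidist_const_le (Nat.succ_ne_zero n) (U ω)
      rw [Nat.cast_succ, add_sub_cancel_right] at h2
      linarith)
  rw [expect_const, expect_add, expect_const_mul, expect_const_mul, expect_sub, expect_sum] at hfin
  simp only [Finset.sum_const, Finset.card_univ, Fintype.card_fin, nsmul_eq_mul] at hdists hneg hD
  push_cast at hdists hneg hD
  generalize p.expect (fun ω => Law.H (U ω * U ω)) - p.expect (fun ω => Law.H (U ω)) = b at *
  generalize ∑ i, p.expect (fun ω => Law.dist (μ i) (U ω)) = d at *
  generalize ∑ i, Law.H (μ i) = s at *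
  generalize Law.H (∏ i, μ i) = S at *
  generalize p.ent (fun ω => (Z₂ ω, Z₃ ω, W ω)) = h at *
  generalize p.ent (fun ω => (Z₃ ω, W ω)) = h3 at *
  generalize p.ent (fun ω => (Z₂ ω, W ω)) = h2 at *
  generalize p.ent (fun ω => (Z₁ ω, W ω)) = h1 at *
  set M : ℝ := (n : ℝ) + 1 with hM
  have hM2 : 2 ≤ M := by
    have : (1 : ℝ) ≤ n := by exact_mod_cast hn
    linarith
  have hnM : (n : ℝ) = M - 1 := by rw [hM]; ring
  have b1 : b ≤ 3 * t := by linarith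
  -- Given `W`, conditioning `Z₂` further on `Z₃` costs at most `t` (`I23`), and conditioning on `W`
  -- costs at most H[W] - `S` (`hZW`), hence at most 2nk.
  have b2 : S - 2 * n * k - t ≤ h - h3 := by linarith
  have b3 : d ≤ M * ((4 * M ^ 2 + M + 1) * k + t / 2) := by
    have := mul_le_mul_of_nonneg_left b2 (show 0 ≤ M by linarith)
    rw [hnM] at this
    nlinarith
  have b4 : (1 - η) * k ≤ M * (3 * t) + η * (M * ((4 * M ^ 2 + M + 1) * k + t / 2)) := by
    refine hfin.trans (add_le_add ?_ (mul_le_mul_of_nonneg_left b3 hη0))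
    have t0 : 0 ≤ t := by positivity
    calc (n : ℝ) * b ≤ n * (3 * t) := mul_le_mul_of_nonneg_left b1 (by positivity)
      _ ≤ M * (3 * t) := mul_le_mul_of_nonneg_right (by linarith) (by linarith)
  have b5 : (1 - η) * k ≤
      (12 * (η * M ^ 3) + 4 * (η * M ^ 3) + η * M ^ 2 + η * M + 2 * η * (η * M ^ 3)) * k := by
    refine b4.trans (le_of_eq ?_)
    simp only [t]
    ring
  have b6 : 1 - η ≤
      12 * (η * M ^ 3) + 4 * (η * M ^ 3) + η * M ^ 2 + η * M + 2 * η * (η * M ^ 3) :=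
    le_of_mul_le_mul_right b5 hk
  have c1 : η * M ^ 3 = c := by rw [hη]; field_simp
  have c2 : η * M ^ 2 ≤ η * M ^ 3 :=
    mul_le_mul_of_nonneg_left (pow_le_pow_right₀ (by linarith) (by norm_num)) hη0
  have c3 : η * M ≤ η * M ^ 3 :=
    mul_le_mul_of_nonneg_left (le_self_pow₀ (by linarith) (by norm_num)) hη0
  have c4 : η ≤ η * M ^ 3 := le_mul_of_one_le_right hη0 (one_le_pow₀ (by linarith))
  rw [c1] at b6 c2 c3 c4
  -- As η ≤ c, the right side of `b6` is at most 18c + 2c², while the left is at least 1 - c; c ≤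
  -- 1/100 makes this absurd.
  nlinarith

end Decrement

/-! ### From random variables to finite models. -/

section Model

variable {Ω : Type*} [MeasurableSpace Ω] {B : Type*} [Fintype B]

/-- The map `e` to a finite type has events as fibres, and its distribution is `p`. -/
def IsModel (P : Measure Ω) (p : FinProb B) (e : Ω → B) : Prop :=
  ∀ b, MeasurableSet (e ⁻¹' {b}) ∧ P.real (e ⁻¹' {b}) = p.w b

lemma IsModel.real_preimage {P : Measure Ω} [IsProbabilityMeasure P] {p : FinProb B} {e : Ω → B}
    (h : IsModel P p e) {α : Type*} (f : B → α) (a : α) :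
    P.real ((fun ω => f (e ω)) ⁻¹' {a}) = p.pr f a := by
  classical
  have hU : (fun ω => f (e ω)) ⁻¹' {a} = ⋃ b ∈ Finset.univ.filter (fun b => f b = a), e ⁻¹' {b} := by
    ext ω
    simp
  rw [hU, measureReal_biUnion_finset, FinProb.pr, Finset.sum_filter]
  · exact Finset.sum_congr rfl fun b _ => by rw [(h b).2]
  · intro b _ b' _ hbb'
    exact Disjoint.preimage _ (by simpa using hbb')
  · intro b _
    exact (h b).1

lemma IsModel.entropy {G : Type u} {P : Measure Ω} [IsProbabilityMeasure P] {p : FinProb B}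
    {e : Ω → B} (h : IsModel P p e) [AddCommGroup G] (f : B → G) :
    entropy P (fun ω => f (e ω)) = p.ent f := by
  rw [_root_.entropy, ← Law.H_law, Law.H, Law.ent, ← tsum_eq_sum (L := SummationFilter.unconditional G)]
  · refine tsum_congr fun g => ?_
    rw [h.real_preimage, FinProb.law_coeff]
  · intro g hg
    rw [Finsupp.notMem_support_iff.1 hg, Real.negMulLog_zero]

lemma IsModel.prod {Ω' B' : Type*} [MeasurableSpace Ω'] [Fintype B'] {P : Measure Ω} {P' : Measure Ω'}
    [IsProbabilityMeasure P] [IsProbabilityMeasure P'] {p : FinProb B} {p' : FinProb B'} {e : Ω → B}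
    {e' : Ω' → B'} (h : IsModel P p e) (h' : IsModel P' p' e') :
    IsModel (P.prod P') (p.prod p') (fun ω => (e ω.1, e' ω.2)) := by
  rintro ⟨b, b'⟩
  have : (fun ω : Ω × Ω' => (e ω.1, e' ω.2)) ⁻¹' {(b, b')} = (e ⁻¹' {b}) ×ˢ (e' ⁻¹' {b'}) := by
    ext ω
    simp
  rw [this]
  refine ⟨(h b).1.prod (h' b').1, ?_⟩
  rw [measureReal_prod_prod, (h b).2, (h' b').2]
  rfl

lemma IsModel.pi {ι : Type*} [Fintype ι] [DecidableEq ι] {Ω : ι → Type*}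
    [∀ i, MeasurableSpace (Ω i)] {P : ∀ i, Measure (Ω i)} [∀ i, IsProbabilityMeasure (P i)]
    {q : ι → FinProb B} {e : ∀ i, Ω i → B} (h : ∀ i, IsModel (P i) (q i) (e i)) :
    IsModel (Measure.pi P) (FinProb.pi q) (fun ω i => e i (ω i)) := by
  intro b
  have : (fun (ω : ∀ i, Ω i) i => e i (ω i)) ⁻¹' {b} =
      Set.pi Set.univ fun i => e i ⁻¹' {b i} := by
    ext ω
    simp [funext_iff]
  rw [this]
  refine ⟨MeasurableSet.univ_pi fun i => (h i (b i)).1, ?_⟩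
  rw [measureReal_def, Measure.pi_pi, ENNReal.toReal_prod]
  exact Finset.prod_congr rfl fun i _ => (h i (b i)).2

end Model

namespace FinRV

variable {G : Type u}

/-- A finitely-valued random variable as a map to a finite set containing its range. -/
def proj (X : FinRV.{u, v} G) (s : Finset G) (hs : X.val.range ⊆ s) (ω : X.Ω) : s :=
  ⟨X.val ω, hs (X.val.mem_range_self ω)⟩

/-- The distribution of a finitely-valued random variable on a finite set containing its range. -/
noncomputable def model (X : FinRV.{u, v} G) (s : Finset G) (hs : X.val.range ⊆ s) : FinProb s where
  w g := X.P.real (X.val ⁻¹' {(g : G)})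
  nonneg g := measureReal_nonneg
  sum_eq_one := by
    have h := measureReal_biUnion_finset (μ := X.P) (s := (Finset.univ : Finset s))
      (f := fun g => X.val ⁻¹' {(g : G)})
      (fun g _ g' _ hgg' => Disjoint.preimage _ (by
        rw [Set.disjoint_singleton]
        exact fun h => hgg' (Subtype.ext h)))
      (fun g _ => X.val.measurableSet_preimage _)
    rw [← h]
    have : ⋃ g ∈ (Finset.univ : Finset s), X.val ⁻¹' {(g : G)} = Set.univ := by
      ext ω
      simp only [Finset.mem_univ, Set.iUnion_true, Set.mem_iUnion, Set.mem_preimage,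
        Set.mem_singleton_iff, Set.mem_univ, iff_true]
      exact ⟨X.proj s hs ω, rfl⟩
    rw [this]
    simp

lemma isModel (X : FinRV.{u, v} G) (s : Finset G) (hs : X.val.range ⊆ s) :
    IsModel X.P (X.model s hs) (X.proj s hs) := by
  intro g
  have : X.proj s hs ⁻¹' {g} = X.val ⁻¹' {(g : G)} := by
    ext ω
    simp [proj, Subtype.ext_iff]
  rw [this]
  exact ⟨X.val.measurableSet_preimage _, rfl⟩

variable [AddCommGroup G]

/-- The law of a finitely-valued random variable. -/
noncomputable def law (X : FinRV.{u, v} G) : Law G :=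
  (X.model X.val.range (Finset.Subset.refl _)).law fun g => (g : G)

lemma law_coeff (X : FinRV.{u, v} G) (g : G) : X.law.1.coeff g = X.P.real (X.val ⁻¹' {g}) := by
  rw [law, FinProb.law_coeff]
  exact ((X.isModel _ _).real_preimage (fun g => (g : G)) g).symm

lemma model_law (X : FinRV.{u, v} G) (s : Finset G) (hs : X.val.range ⊆ s) :
    (X.model s hs).law (fun g => (g : G)) = X.law := by
  apply Subtype.ext
  ext g
  rw [law_coeff, FinProb.law_coeff]
  exact ((X.isModel s hs).real_preimage (fun g => (g : G)) g).symm

lemma H_eq (X : FinRV.{u, v} G) : X.H = Law.H X.law := by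
  rw [law, Law.H_law]
  exact (X.isModel _ _).entropy fun g => (g : G)

lemma ruzsaDist_eq (X Y : FinRV.{u, v} G) : X.ruzsaDist Y = Law.dist X.law Y.law := by
  rw [ruzsaDist, Law.dist, H_eq, H_eq]
  congr 2
  have h := ((X.isModel _ (Finset.Subset.refl _)).prod (Y.isModel _ (Finset.Subset.refl _))).entropy
    (fun g => (g.1 : G) + -(g.2 : G))
  rw [← Law.H_law, FinProb.law_add_prod _ _ (fun g : X.val.range => (g : G))
    (fun g : Y.val.range => -(g : G)), ← Law.neg_law] at h
  rw [law, law, ← h]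
  simp only [sub_eq_add_neg]
  rfl

lemma multidist_eq {I : Type} [Fintype I] (X : I → FinRV.{u, v} G) :
    multidist X = Law.multidist fun i => (X i).law := by
  classical
  rw [multidist, Law.multidist]
  simp only [H_eq]
  congr 1
  -- Finite products of weights are over one fixed type, so all the variables are modelled on the
  -- union of their ranges.
  let s : Finset G := Finset.univ.biUnion fun i => (X i).val.range
  have hs : ∀ i, (X i).val.range ⊆ s := fun i =>
    Finset.subset_biUnion_of_mem (fun i => (X i).val.range) (Finset.mem_univ i)
  have h := (IsModel.pi fun i => (X i).isModel s (hs i)).entropy (fun b => ∑ i, ((b i : s) : G))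
  rw [← Law.H_law, FinProb.law_sum_pi _ (fun _ (g : s) => (g : G))] at h
  simp only [model_law] at h
  exact h

/-- Every law is the law of a random variable with values in its support. -/
lemma exists_law_eq (μ : Law G) : ∃ X : FinRV.{u, v} G, X.law = μ ∧
    ∀ T : Set G, Law.SupportedIn μ T → X.TakesValuesIn T := by
  let N := Fintype.card μ.1.coeff.support
  -- The support of `μ` lives in the universe of `G`; relabelling by a lifted `Fin N` puts the
  -- sample space in the required one.
  let e : ULift.{v} (Fin N) ≃ μ.1.coeff.support :=
    Equiv.ulift.trans (Fintype.equivFin μ.1.coeff.support).symm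
  let w : PMF (ULift.{v} (Fin N)) := PMF.ofFintype (fun b => ENNReal.ofReal (μ.space.w (e b))) (by
    rw [← ENNReal.ofReal_sum_of_nonneg fun b _ => μ.space.nonneg _,
      Equiv.sum_comp e fun g => μ.space.w g, μ.space.sum_eq_one, ENNReal.ofReal_one])
  let _ : MeasurableSpace (ULift.{v} (Fin N)) := ⊤
  let X : FinRV.{u, v} G :=
    { Ω := ULift.{v} (Fin N)
      P := w.toMeasure
      val :=
        { toFun := fun b => e b
          measurableSet_fiber' := fun _ => trivial
          finite_range' := Set.finite_range _ } }
  refine ⟨X, ?_, fun T hT b => hT _ (Finsupp.mem_support_iff.1 (e b).2)⟩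
  have hmod : IsModel X.P μ.space (fun b : ULift.{v} (Fin N) => e b) := by
    intro g
    have : (fun b : ULift.{v} (Fin N) => e b) ⁻¹' {g} = {e.symm g} := by
      ext b
      simp [Equiv.eq_symm_apply]
    rw [this]
    refine ⟨trivial, ?_⟩
    have h1 : w.toMeasure {e.symm g} = w (e.symm g) :=
      PMF.toMeasure_apply_singleton _ _ trivial
    change (w.toMeasure {e.symm g}).toReal = _
    rw [h1]
    simp only [w, PMF.ofFintype_apply, Equiv.apply_symm_apply]
    exact ENNReal.toReal_ofReal (μ.space.nonneg _)
  apply Subtype.ext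
  ext g
  rw [law_coeff, ← Law.law_space μ, FinProb.law_coeff]
  exact hmod.real_preimage (fun g => (g : G)) g

end FinRV

/-! ### Iterated sumsets. -/

section IterSumset

variable {G : Type u} [AddCommGroup G] {S : Set G}

lemma iterSumset_one {x : G} (hx : x ∈ S) : x ∈ iterSumset 1 S :=
  ⟨fun _ => x, fun _ => hx, by simp⟩

lemma iterSumset_zero : (0 : G) ∈ iterSumset 0 S := ⟨fun _ => 0, fun k => k.elim0, by simp⟩

lemma iterSumset_add {a b : ℕ} {x y : G} (hx : x ∈ iterSumset a S) (hy : y ∈ iterSumset b S) :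
    x + y ∈ iterSumset (a + b) S := by
  obtain ⟨f, hf, rfl⟩ := hx
  obtain ⟨g, hg, rfl⟩ := hy
  refine ⟨Fin.append f g, fun k => ?_, by simp [Fin.sum_univ_add]⟩
  refine Fin.addCases (fun i => ?_) (fun i => ?_) k
  · simpa using hf i
  · simpa using hg i

lemma iterSumset_zero_mem (h0 : (0 : G) ∈ S) (a : ℕ) : (0 : G) ∈ iterSumset a S :=
  ⟨fun _ => 0, fun _ => h0, by simp⟩

lemma iterSumset_mono (h0 : (0 : G) ∈ S) {a b : ℕ} (hab : a ≤ b) {x : G}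
    (hx : x ∈ iterSumset a S) : x ∈ iterSumset b S := by
  have := iterSumset_add hx (iterSumset_zero_mem h0 (b - a))
  rwa [add_zero, Nat.add_sub_cancel' hab] at this

lemma iterSumset_nsmul {x : G} (hx : x ∈ S) (n : ℕ) : n • x ∈ iterSumset n S :=
  ⟨fun _ => x, fun _ => hx, by simp⟩

lemma iterSumset_sum {ι : Type*} (s : Finset ι) (x : ι → G) (a : ι → ℕ)
    (hx : ∀ i, x i ∈ iterSumset (a i) S) : ∑ i ∈ s, x i ∈ iterSumset (∑ i ∈ s, a i) S := by
  classical
  induction s using Finset.induction_on with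
  | empty => exact iterSumset_zero
  | insert i s hi ih =>
    rw [Finset.sum_insert hi, Finset.sum_insert hi]
    exact iterSumset_add (hx i) ih

end IterSumset

/-- If there were no such tuple, realizing arbitrary laws by random variables would show that the
laws of `X` are near-minimal. -/
lemma FinRV.exists_decrement {G : Type u} [AddCommGroup G] {n : ℕ} (hn : 1 ≤ n)
    (hG : ∀ g : G, (n + 1) • g = 0) {c η : ℝ} (hc0 : 0 < c) (hc : c ≤ 1 / 100)
    (hη : η = c / ((n : ℝ) + 1) ^ 3) (X : Fin (n + 1) → FinRV.{u, v} G) (hX : 0 < multidist X)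
    (S : Set G) (h0 : 0 ∈ S) (hS : ∀ i, (X i).TakesValuesIn S) :
    ∃ X' : Fin (n + 1) → FinRV.{u, v} G,
      multidist X' ≤ (1 - η) * multidist X - η * ∑ i, (X i).ruzsaDist (X' i) ∧
        ∀ i, (X' i).TakesValuesIn (iterSumset ((n + 1) ^ 3) S) := by
  classical
  by_contra! hcon
  let s : Finset G := Finset.univ.biUnion fun i => (X i).val.range
  have hs : ∀ i, (X i).val.range ⊆ s := fun i =>
    Finset.subset_biUnion_of_mem (fun i => (X i).val.range) (Finset.mem_univ i)
  have hsS : ∀ g : s, (g : G) ∈ S := by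
    rintro ⟨g, hg⟩
    obtain ⟨i, -, hi⟩ := Finset.mem_biUnion.1 hg
    obtain ⟨ω, rfl⟩ := SimpleFunc.mem_range.1 hi
    exact hS i ω
  rw [multidist_eq] at hX
  refine not_nearMin hn hG (fun i => (X i).law) (fun i => (X i).model s (hs i)) (fun g => (g : G))
    (fun i => (X i).model_law s (hs i)) (T := iterSumset ((n + 1) ^ 3) S) hc0 hc hη hX ?_ ?_ ?_ ?_
  · exact fun g => iterSumset_mono h0 (Nat.one_le_pow _ _ (Nat.succ_pos n)) (iterSumset_one (hsS g))
  · intro b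
    refine iterSumset_mono h0 ?_ (iterSumset_sum Finset.univ (fun j => (b j : G)) (fun _ => 1)
      fun j => iterSumset_one (hsS (b j)))
    simpa using Nat.le_self_pow (by norm_num) (n + 1)
  · intro ω
    refine iterSumset_mono h0 ?_ (iterSumset_sum Finset.univ _ _ fun i =>
      iterSumset_sum Finset.univ _ _ fun j => iterSumset_nsmul (hsS (ω i j)) j)
    -- The origin of m³: the array has m² entries, each with a weight at most m.
    refine (Finset.sum_le_sum fun i _ => Finset.sum_le_sum (g := fun _ => n + 1)
      fun (j : Fin (n + 1)) _ => j.2.le).trans (le_of_eq ?_)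
    simp
    ring
  · intro μ' hμ'
    choose X' hX' hX'T using fun i => exists_law_eq.{u, v} (μ' i)
    have h := hcon X'
    by_contra! hlt
    obtain ⟨i, hi⟩ := h (by
      rw [multidist_eq, multidist_eq]
      simp only [ruzsaDist_eq, hX']
      exact hlt.le)
    exact hi (hX'T i _ (hμ' i))

theorem proposition2p3 :
    ∃ c₀ : ℝ, 0 < c₀ ∧ ∀ c : ℝ, 0 < c → c ≤ c₀ →
      ∀ m : ℕ, 2 ≤ m →
      ∀ (G : Type u) [AddCommGroup G], (∀ g : G, m • g = 0) →
      ∀ η : ℝ, η = c / (m : ℝ) ^ 3 →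
      ∀ X : Fin m → FinRV.{u, v} G, 0 < FinRV.multidist X →
        (∃ X' : Fin m → FinRV.{u, v} G,
          FinRV.multidist X' ≤
            (1 - η) * FinRV.multidist X - η * ∑ i, (X i).ruzsaDist (X' i)) ∧
        (∀ S : Set G, 0 ∈ S → (∀ s ∈ S, -s ∈ S) → (∀ i, (X i).TakesValuesIn S) →
          ∃ X' : Fin m → FinRV.{u, v} G,
            FinRV.multidist X' ≤
              (1 - η) * FinRV.multidist X - η * ∑ i, (X i).ruzsaDist (X' i) ∧
            ∀ i, (X' i).TakesValuesIn (iterSumset (m ^ 3) S)) := by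
  refine ⟨1 / 100, by norm_num, fun c hc0 hc m hm G _ hG η hη X hX => ?_⟩
  obtain ⟨n, rfl⟩ := Nat.exists_eq_succ_of_ne_zero (show m ≠ 0 by omega)
  have hη' : η = c / ((n : ℝ) + 1) ^ 3 := by rw [hη]; push_cast; rfl
  have key := FinRV.exists_decrement (by omega) hG hc0 hc hη' X hX
  refine ⟨?_, fun S h0 _ hS => key S h0 hS⟩
  -- The unrestricted statement is the case S = G.
  obtain ⟨X', h, -⟩ := key Set.univ (Set.mem_univ _) fun _ _ => Set.mem_univ _
  exact ⟨X', h⟩
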